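/- Let $n \ge 5$, let $\mathbb{F}_{2^n}$ be the field with $2^n$ elements, and let $F\colon \mathbb{F}_{2^n}\to\mathbb{F}_{2^n}$ be the inverse function $F(x)=x^{-1}$, with the convention $0^{-1}=0$ (that is, $F(x)=x^{2^n-2}$). Affine maps are understood over $\mathbb{F}_2$. Two functions $F_1,F_2\colon\mathbb{F}_{2^n}\to\mathbb{F}_{2^n}$ are called - *EA-equivalent* if there are affine permutations $A_1,A_2$ and an affine map $A_3$ of $\mathbb{F}_{2^n}$ with $A_1(F_1(A_2(x)))+A_3(x)=F_2(x)$ for all $x$; - *affine equivalent* if this is possible with $A_3=0$; - *CCZ-equivalent* if there is an affine bijection of $\mathbb{F}_{2^n}\times\mathbb{F}_{2^n}$ that maps the graph $\{(x,F_1(x)) : x\in\mathbb{F}_{2^n}\}$ onto the graph $\{(x,F_2(x)) : x\in\mathbb{F}_{2^n}\}$. Then the set of all functions $\mathbb{F}_{2^n}\to\mathbb{F}_{2^n}$ that are CCZ-equivalent to $F$ coincides with the set of all functions that are EA-equivalent to $F$. Moreover, every permutation of $\mathbb{F}_{2^n}$ that is CCZ-equivalent to $F$ is affine equivalent to $F$.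 -/

import Mathlib

/-- Affine equivalence of two functions on an `𝔽₂`-vector space `V`:
`A₁ (F₁ (A₂ x)) = F₂ x` for some affine permutations `A₁, A₂` of `V`. -/
def AffineEquivalent {V : Type*} [AddCommGroup V] [Module (ZMod 2) V] (F₁ F₂ : V → V) : Prop :=
  ∃ A₁ A₂ : V ≃ᵃ[ZMod 2] V, ∀ x, A₁ (F₁ (A₂ x)) = F₂ x

/-- Extended affine equivalence (EA-equivalence): `A₁ (F₁ (A₂ x)) + A₃ x = F₂ x` for some affine
permutations `A₁, A₂` and some affine (not necessarily bijective) map `A₃` of `V`. -/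
def EAEquivalent {V : Type*} [AddCommGroup V] [Module (ZMod 2) V] (F₁ F₂ : V → V) : Prop :=
  ∃ (A₁ A₂ : V ≃ᵃ[ZMod 2] V) (A₃ : V →ᵃ[ZMod 2] V), ∀ x, A₁ (F₁ (A₂ x)) + A₃ x = F₂ x

/-- CCZ-equivalence: some affine permutation of `V × V` maps the graph
`{(x, F₁ x) : x ∈ V}` onto the graph `{(x, F₂ x) : x ∈ V}`. -/
def CCZEquivalent {V : Type*} [AddCommGroup V] [Module (ZMod 2) V] (F₁ F₂ : V → V) : Prop :=
  ∃ A : (V × V) ≃ᵃ[ZMod 2] (V × V), A '' (Set.univ.graphOn F₁) = Set.univ.graphOn F₂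

/-- The inverse function `x ↦ x⁻¹`, with the convention `0⁻¹ = 0`. -/
def inverseFunction (K : Type*) [Field K] : K → K := fun x => x⁻¹

/-- On a field with `2 ^ n` elements, `n ≥ 2`, the inverse function is the power function
`x ↦ x ^ (2 ^ n - 2)`. -/
theorem inverseFunction_eq_pow (n : ℕ) (hn : 2 ≤ n) (K : Type*) [Field K]
    (hK : Nat.card K = 2 ^ n) (x : K) : inverseFunction K x = x ^ (2 ^ n - 2) := by
  have h4 : 4 ≤ 2 ^ n := le_trans (by norm_num) (Nat.pow_le_pow_right (n := 2) (by norm_num) hn)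
  have hfin : Finite K := Nat.finite_of_card_ne_zero (by omega)
  have := Fintype.ofFinite K
  unfold inverseFunction
  by_cases hx : x = 0
  · subst hx
    rw [inv_zero, zero_pow (by omega)]
  · have h1 : x ^ (2 ^ n - 1) = 1 := by
      rw [← hK, Nat.card_eq_fintype_card]
      exact FiniteField.pow_card_sub_one_eq_one x hx
    refine inv_eq_of_mul_eq_one_right ?_
    rw [← pow_succ', ← h1]
    congr 1
    omega

set_option linter.unusedSectionVars false

/-! Suppose an affine bijection carries the graph of inversion to that of `G`, and let `a`, `b` be
the linear blocks producing its first coordinate. Projecting the image graph shows that `u ↦ a u + b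
u⁻¹` is a permutation. The crux, `eq_zero_or_eq_zero_of_bijective`, is that then `a = 0` or `b = 0`.
EA-equivalence can then be read off the block matrix. If moreover `G` is a permutation, the crux
applied again forces the added affine map to be constant.

For the crux let `D = {(x, y) | a y + b x = 0}`, which is also the set of pairs (a* v, b* v) of
trace adjoints. `isInverseSpace_of_bijective` extracts three properties: `tr (x y)⁻¹ = 1` off the
axes (injectivity and Artin–Schreier), `tr (x y) = 0` (a Kloosterman count modulo 4), and closure
under a product `star_mem` (third moments modulo 2). `IsInverseSpace.eq_axis` shows that such a `D`,
of dimension n, is a coordinate axis.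

If `D` contained nonzero points of both axes, the product would give an operator on `D` with an
eigenvalue outside `K`, while counting puts that eigenvalue in `K`. If `D` met neither axis, it
would be the graph of an injective map `A` with `tr (A y * y)` alternating: impossible in odd
dimension by degeneracy, in even dimension by Chevalley–Warning. If `D` met exactly one axis without
being equal to it, scaling gives `A ≠ 0` with `A 1 = 0` commuting with `y ↦ y² + √y`. For n odd this
determines `A` explicitly; for n = 2m the kernel of `A` is the subfield with 2^m elements. In both
parities the trace condition becomes a relation between traces of an element and of its inverse,
which fails when tested on three elements of sum zero. -/

theorem zmod_two_cases (a : ZMod 2) : a = 0 ∨ a = 1 := by revert a; decide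

theorem zmod_two_ne_one {a : ZMod 2} : a ≠ 1 ↔ a = 0 := by revert a; decide

/-! ### Trace, Frobenius and power sums in characteristic two. -/

section Basics

variable {K : Type*} [Field K] [Fintype K] [Algebra (ZMod 2) K] [CharP K 2]

/-- The absolute trace of a finite field of characteristic two. -/
noncomputable abbrev tr : K →ₗ[ZMod 2] ZMod 2 := Algebra.trace (ZMod 2) K

/-- The Frobenius automorphism `x ↦ x ^ 2`. -/
noncomputable def frob : K ≃ₐ[ZMod 2] K := FiniteField.frobeniusAlgEquivOfAlgebraic (ZMod 2) K

/-- The square root, inverse to the Frobenius automorphism. -/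
noncomputable def rt : K ≃ₐ[ZMod 2] K := frob.symm

theorem frob_apply (x : K) : frob x = x ^ 2 := by
  simp [frob, ZMod.card]

@[simp]
theorem rt_sq (x : K) : rt x ^ 2 = x := by
  rw [← frob_apply, rt, AlgEquiv.apply_symm_apply]

@[simp]
theorem rt_sq' (x : K) : rt (x ^ 2) = x := by
  rw [← frob_apply, rt, AlgEquiv.symm_apply_apply]

@[simp]
theorem tr_sq (x : K) : tr (x ^ 2) = tr x := by
  rw [← frob_apply]
  exact Algebra.trace_eq_of_algEquiv frob x

@[simp]
theorem tr_rt (x : K) : tr (rt x) = tr x := by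
  rw [← tr_sq (rt x), rt_sq]

theorem sq_injective {x y : K} (h : x ^ 2 = y ^ 2) : x = y := by
  rw [← rt_sq' x, h, rt_sq']

theorem eq_zero_of_tr_mul {x : K} (h : ∀ y, tr (x * y) = 0) : x = 0 :=
  (traceForm_nondegenerate (ZMod 2) K).1 x h

theorem exists_tr_eq_one : ∃ x : K, tr x = 1 := by
  by_contra! h
  have : (1 : K) = 0 := eq_zero_of_tr_mul fun y => by
    rw [one_mul]; exact zmod_two_ne_one.1 (h y)
  exact one_ne_zero this

/-- Every linear functional is of the form `x ↦ tr (c * x)`. -/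
theorem exists_tr_mul_eq (f : K →ₗ[ZMod 2] ZMod 2) : ∃ c : K, ∀ x, f x = tr (c * x) := by
  refine ⟨((Algebra.traceForm (ZMod 2) K).toDual (traceForm_nondegenerate (ZMod 2) K)).symm f,
    fun x => ?_⟩
  have := LinearMap.BilinForm.apply_toDual_symm_apply
    (hB := traceForm_nondegenerate (ZMod 2) K) f x
  rw [← this, Algebra.traceForm_apply]

/-- Additive Hilbert 90 for the Frobenius automorphism. -/
theorem exists_sq_add_self {c : K} (hc : tr c = 0) : ∃ r : K, r ^ 2 + r = c := by
  let T : K →ₗ[ZMod 2] K := frob.toLinearMap + LinearMap.id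
  have hT : ∀ r, T r = r ^ 2 + r := fun r => by simp [T, frob_apply]
  have hle : LinearMap.range T ≤ LinearMap.ker (tr (K := K)) := by
    rintro _ ⟨r, rfl⟩
    rw [LinearMap.mem_ker, hT, map_add, tr_sq, CharTwo.add_self_eq_zero]
  have hker : Module.finrank (ZMod 2) (LinearMap.ker T) ≤ 1 := by
    refine finrank_le_one (⟨1, by
      rw [LinearMap.mem_ker, hT, one_pow, CharTwo.add_self_eq_zero]⟩ : LinearMap.ker T) ?_
    rintro ⟨w, hw⟩
    rw [LinearMap.mem_ker, hT] at hw
    have : w * (w + 1) = 0 := by rw [← hw]; ring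
    rcases mul_eq_zero.1 this with h | h
    · exact ⟨0, by ext; simp [h]⟩
    · exact ⟨1, by ext; simpa using (CharTwo.add_eq_zero.1 h).symm⟩
  have hsurj : LinearMap.range (tr (K := K)) = ⊤ := by
    rw [LinearMap.range_eq_top]
    exact Algebra.trace_surjective (ZMod 2) K
  have h1 := LinearMap.finrank_range_add_finrank_ker T
  have h2 := LinearMap.finrank_range_add_finrank_ker (tr (K := K))
  rw [hsurj, finrank_top, Module.finrank_self] at h2
  have heq := Submodule.eq_of_le_of_finrank_le hle (by omega)
  have : c ∈ LinearMap.range T := by rw [heq]; exact hc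
  obtain ⟨r, hr⟩ := this
  exact ⟨r, by rw [← hT, hr]⟩

theorem card_eq_two_pow : Fintype.card K = 2 ^ Module.finrank (ZMod 2) K := by
  have := Module.card_eq_pow_finrank (K := ZMod 2) (V := K)
  rwa [ZMod.card] at this

theorem algebraMap_tr (x : K) :
    algebraMap (ZMod 2) K (tr x) =
      ∑ i ∈ Finset.range (Module.finrank (ZMod 2) K), x ^ 2 ^ i := by
  rw [FiniteField.algebraMap_trace_eq_sum_pow, Nat.card_zmod]

theorem pow_two_pow_finrank (x : K) : x ^ 2 ^ Module.finrank (ZMod 2) K = x := by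
  rw [← card_eq_two_pow, FiniteField.pow_card]

/-- Power sums with positive and negative exponents. -/
theorem sum_pow_mul_inv_pow (a b : ℕ) (hb : b ≠ 0) :
    ∑ u : K, u ^ a * u⁻¹ ^ b = if a ≡ b [MOD (Fintype.card K - 1)] then 1 else 0 := by
  classical
  have hq : 2 ≤ Fintype.card K := Fintype.one_lt_card
  have hinv : ∀ u : K, u ≠ 0 → u⁻¹ = u ^ (Fintype.card K - 2) := fun u hu => by
    refine inv_eq_of_mul_eq_one_right ?_
    rw [← pow_succ', ← FiniteField.pow_card_sub_one_eq_one u hu]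
    congr 1; omega
  have h0 : ∑ u : K, u ^ a * u⁻¹ ^ b =
      ∑ u : Kˣ, (u : K) ^ (a + (Fintype.card K - 2) * b) := by
    rw [← Fintype.sum_subtype_add_sum_subtype (fun u : K => u ≠ 0)]
    -- `b ≠ 0` kills the term at `u = 0`, even when `a = 0` and `0 ^ a = 1`.
    have : ∑ u : {u : K // ¬ u ≠ 0}, (u : K) ^ a * (u : K)⁻¹ ^ b = 0 := by
      refine Finset.sum_eq_zero fun u _ => ?_
      have : (u : K) = 0 := not_not.1 u.2
      simp [this, hb]
    rw [this, add_zero]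
    refine (Fintype.sum_equiv unitsEquivNeZero _ _ fun u => ?_).symm
    rw [pow_add, pow_mul, ← hinv _ u.ne_zero]
    rfl
  rw [h0, FiniteField.sum_pow_units]
  have : Fintype.card K - 1 ∣ a + (Fintype.card K - 2) * b ↔ a ≡ b [MOD (Fintype.card K - 1)] := by
    obtain ⟨q, hq'⟩ : ∃ q, Fintype.card K = q + 2 := ⟨_, (Nat.sub_add_cancel hq).symm⟩
    rw [hq', show q + 2 - 1 = q + 1 by omega, show q + 2 - 2 = q by omega,
      ← Nat.modEq_zero_iff_dvd]
    have h : q * b + b ≡ 0 [MOD (q + 1)] := by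
      rw [Nat.modEq_zero_iff_dvd]; exact ⟨b, by ring⟩
    constructor
    · intro h1
      have h2 : a + q * b + b ≡ 0 + b [MOD (q + 1)] := h1.add_right b
      have h3 : a + (q * b + b) ≡ a + 0 [MOD (q + 1)] := h.add_left a
      rw [← add_assoc] at h3
      rw [zero_add] at h2
      rw [add_zero] at h3
      exact h3.symm.trans h2
    · intro h1
      have h2 : a + q * b ≡ b + q * b [MOD (q + 1)] := h1.add_right _
      rw [add_comm b] at h2
      exact h2.trans h
  simp only [this, CharTwo.neg_eq]

theorem two_pow_modEq_iff {n i j : ℕ} (hi : i < n) (hj : j < n) (hn : 2 ≤ n) :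
    2 ^ i ≡ 2 ^ j [MOD (2 ^ n - 1)] ↔ i = j := by
  refine ⟨fun h => ?_, fun h => h ▸ Nat.ModEq.refl _⟩
  obtain ⟨m, rfl⟩ : ∃ m, n = m + 2 := ⟨_, (Nat.sub_add_cancel hn).symm⟩
  have h1 : 2 ^ i ≤ 2 ^ (m + 1) := Nat.pow_le_pow_right (by norm_num) (by omega)
  have h2 : 2 ^ j ≤ 2 ^ (m + 1) := Nat.pow_le_pow_right (by norm_num) (by omega)
  have h3 : 2 ^ (m + 2) = 2 * 2 ^ (m + 1) := by ring
  have h4 : 2 ≤ 2 ^ (m + 1) := by rw [pow_succ]; have := Nat.one_le_two_pow (n := m); omega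
  have := Nat.ModEq.eq_of_lt_of_lt h (by omega) (by omega)
  exact Nat.pow_right_injective le_rfl this

theorem two_pow_self_modEq (n : ℕ) : 2 ^ n ≡ 2 ^ 0 [MOD (2 ^ n - 1)] :=
  ((Nat.modEq_iff_dvd' Nat.one_le_two_pow).2 dvd_rfl).symm

/-- Modulo `2 ^ n - 1` exponents of 2 are cyclic. Two distinct binary digits never merge into one,
while equal ones carry to the next position. -/
theorem two_pow_add_modEq_iff {n i j k : ℕ} (hi : i < n) (hj : j < n) (hk : k < n) (hn : 3 ≤ n) :
    2 ^ i + 2 ^ j ≡ 2 ^ k [MOD (2 ^ n - 1)] ↔ i = j ∧ k = (i + 1) % n := by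
  have aux : ∀ {i j : ℕ}, i < j → j < n → ¬ 2 ^ i + 2 ^ j ≡ 2 ^ k [MOD (2 ^ n - 1)] := by
    intro i j hij hj h
    obtain ⟨m, rfl⟩ : ∃ m, n = m + 3 := ⟨_, (Nat.sub_add_cancel hn).symm⟩
    have h1 : 2 ^ i ≤ 2 ^ (m + 1) := Nat.pow_le_pow_right (by norm_num) (by omega)
    have h2 : 2 ^ j ≤ 2 ^ (m + 2) := Nat.pow_le_pow_right (by norm_num) (by omega)
    have h2' : 2 ^ k ≤ 2 ^ (m + 2) := Nat.pow_le_pow_right (by norm_num) (by omega)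
    have h3 : 2 ^ (m + 3) = 4 * 2 ^ (m + 1) := by ring
    have h5 : 2 ^ (m + 2) = 2 * 2 ^ (m + 1) := by ring
    have h4 : 2 ≤ 2 ^ (m + 1) := by rw [pow_succ]; have := Nat.one_le_two_pow (n := m); omega
    have h6 := Nat.ModEq.eq_of_lt_of_lt h (by omega) (by omega)
    have h7 : 2 ^ i < 2 ^ j := Nat.pow_lt_pow_right (by norm_num) hij
    have h8 : j < k := by
      rw [← Nat.pow_lt_pow_iff_right (a := 2) (by norm_num)]
      have := Nat.one_le_two_pow (n := i)
      omega
    have h9 : 2 ^ (j + 1) ≤ 2 ^ k := Nat.pow_le_pow_right (by norm_num) h8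
    rw [pow_succ] at h9
    omega
  constructor
  · intro h
    have hij : i = j := by
      rcases lt_trichotomy i j with h' | h' | h'
      · exact absurd h (aux h' hj)
      · exact h'
      · rw [add_comm] at h; exact absurd h (aux h' hi)
    subst hij
    refine ⟨rfl, ?_⟩
    rw [← two_mul, ← pow_succ'] at h
    rcases Nat.lt_or_ge (i + 1) n with h' | h'
    · rw [Nat.mod_eq_of_lt h']
      exact ((two_pow_modEq_iff h' hk (by omega)).1 h).symm
    · have : i + 1 = n := by omega
      rw [this, Nat.mod_self]
      rw [this] at h
      exact (two_pow_modEq_iff hk (by omega : 0 < n) (by omega)).1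
        (h.symm.trans (two_pow_self_modEq n))
  · rintro ⟨rfl, rfl⟩
    rw [← two_mul, ← pow_succ']
    rcases Nat.lt_or_ge (i + 1) n with h' | h'
    · rw [Nat.mod_eq_of_lt h']
    · have : i + 1 = n := by omega
      rw [this, Nat.mod_self]
      exact two_pow_self_modEq n

/-- Expand both traces into Frobenius conjugates; by `sum_pow_mul_inv_pow` only the diagonal terms
survive. -/
theorem sum_tr_mul_tr_inv (hn : 2 ≤ Module.finrank (ZMod 2) K) (x y : K) :
    ∑ u : K, tr (x * u) * tr (y * u⁻¹) = tr (x * y) := by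
  apply (algebraMap (ZMod 2) K).injective
  simp only [map_sum, map_mul, algebraMap_tr]
  simp only [Finset.sum_mul_sum, mul_pow]
  rw [Finset.sum_comm]
  refine Finset.sum_congr rfl fun i hi => ?_
  rw [Finset.sum_comm]
  rw [Finset.mem_range] at hi
  have : ∀ j ∈ Finset.range (Module.finrank (ZMod 2) K),
      ∑ u : K, x ^ 2 ^ i * u ^ 2 ^ i * (y ^ 2 ^ j * u⁻¹ ^ 2 ^ j) =
        if i = j then x ^ 2 ^ i * y ^ 2 ^ j else 0 := by
    intro j hj
    rw [Finset.mem_range] at hj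
    have h1 := sum_pow_mul_inv_pow (K := K) (2 ^ i) (2 ^ j) (by positivity)
    rw [card_eq_two_pow] at h1
    simp only [two_pow_modEq_iff hi hj hn] at h1
    rw [Finset.sum_congr rfl fun u _ => mul_mul_mul_comm _ _ _ _, ← Finset.mul_sum, h1]
    split_ifs <;> simp
  rw [Finset.sum_congr rfl this, Finset.sum_ite_eq, if_pos (Finset.mem_range.2 hi)]

theorem pow_two_pow_succ_mod {n : ℕ} (hn : n = Module.finrank (ZMod 2) K) (y : K) (i : ℕ)
    (hi : i < n) : y ^ 2 ^ ((i + 1) % n) = (y ^ 2) ^ 2 ^ i := by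
  rcases Nat.lt_or_ge (i + 1) n with h' | h'
  · rw [Nat.mod_eq_of_lt h', ← pow_mul, ← pow_succ']
  · have h : i + 1 = n := by omega
    rw [h, Nat.mod_self, ← pow_mul, ← pow_succ', h, hn, pow_two_pow_finrank, pow_zero, pow_one]

/-- As for two factors, but the surviving exponents satisfy `2 ^ i + 2 ^ i = 2 ^ (i + 1)`; this
carry is the source of the square on `y`. -/
theorem sum_tr_mul_tr_mul_tr_inv (hn : 3 ≤ Module.finrank (ZMod 2) K) (x x' y : K) :
    ∑ u : K, tr (x * u) * tr (x' * u) * tr (y * u⁻¹) = tr (x * x' * y ^ 2) := by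
  apply (algebraMap (ZMod 2) K).injective
  simp only [map_sum, map_mul, algebraMap_tr]
  simp only [mul_pow]
  set n := Module.finrank (ZMod 2) K with hndef
  have key : ∀ i ∈ Finset.range n, ∀ j ∈ Finset.range n, ∀ k ∈ Finset.range n,
      ∑ u : K, x ^ 2 ^ i * u ^ 2 ^ i * (x' ^ 2 ^ j * u ^ 2 ^ j) * (y ^ 2 ^ k * u⁻¹ ^ 2 ^ k) =
        if i = j ∧ k = (i + 1) % n then x ^ 2 ^ i * x' ^ 2 ^ j * y ^ 2 ^ k else 0 := by
    intro i hi j hj k hk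
    rw [Finset.mem_range] at hi hj hk
    have h1 := sum_pow_mul_inv_pow (K := K) (2 ^ i + 2 ^ j) (2 ^ k) (by positivity)
    rw [card_eq_two_pow] at h1
    simp only [← hndef, two_pow_add_modEq_iff hi hj hk hn] at h1
    have : ∀ u : K, x ^ 2 ^ i * u ^ 2 ^ i * (x' ^ 2 ^ j * u ^ 2 ^ j) * (y ^ 2 ^ k * u⁻¹ ^ 2 ^ k) =
        x ^ 2 ^ i * x' ^ 2 ^ j * y ^ 2 ^ k * (u ^ (2 ^ i + 2 ^ j) * u⁻¹ ^ 2 ^ k) := by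
      intro u; rw [pow_add]; ring
    rw [Finset.sum_congr rfl fun u _ => this u, ← Finset.mul_sum, h1]
    split_ifs <;> simp
  have hexp : ∀ a b c : ℕ → K, (∑ i ∈ Finset.range n, a i) * (∑ i ∈ Finset.range n, b i) *
      (∑ i ∈ Finset.range n, c i) = ∑ i ∈ Finset.range n, ∑ j ∈ Finset.range n,
        ∑ k ∈ Finset.range n, a i * b j * c k := by
    intro a b c
    rw [Finset.sum_mul_sum, Finset.sum_mul]
    refine Finset.sum_congr rfl fun i _ => ?_
    rw [Finset.sum_mul_sum]
  simp only [hexp]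
  rw [Finset.sum_comm]
  refine Finset.sum_congr rfl fun i hi => ?_
  rw [Finset.sum_comm, Finset.sum_eq_single_of_mem i hi, Finset.sum_comm,
    Finset.sum_eq_single_of_mem ((i + 1) % n) (Finset.mem_range.2 (Nat.mod_lt _ (by omega))),
    key i hi i hi _ (Finset.mem_range.2 (Nat.mod_lt _ (by omega))), if_pos ⟨rfl, rfl⟩,
    pow_two_pow_succ_mod hndef _ _ (Finset.mem_range.1 hi)]
  · intro k hk hne
    rw [key i hi i hi k hk, if_neg fun h => hne h.2]
  · intro j hj hne
    rw [Finset.sum_comm]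
    refine Finset.sum_eq_zero fun k hk => ?_
    rw [key i hi j hj k hk, if_neg fun h => hne h.1.symm]

end Basics

/-! ### Moments modulo 2 and the space attached to a permutation `u ↦ a u + b u⁻¹`. -/

/-- A function on an `𝔽₂`-space that is invariant under a nonzero translation sums to zero. -/
theorem sum_eq_zero_of_translation {V : Type*} [AddCommGroup V] [Module (ZMod 2) V] [Fintype V]
    (h : V → ZMod 2) (w : V) (hw : w ≠ 0) (hh : ∀ v, h (v + w) = h v) : ∑ v, h v = 0 := by
  have hww : w + w = 0 := ZModModule.add_self w
  refine Finset.sum_involution (fun v _ => v + w) (fun v _ => ?_) (fun v _ _ => ?_)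
    (fun v _ => Finset.mem_univ _) (fun v _ => ?_)
  · rw [hh, CharTwo.add_self_eq_zero]
  · simpa using hw
  · rw [add_assoc, hww, add_zero]

/-- The kernel of `L` contains a nonzero vector, and translation by it pairs off equal terms. -/
theorem sum_comp_linearMap_eq_zero {V M : Type*} [AddCommGroup V] [Module (ZMod 2) V] [Fintype V]
    [AddCommGroup M] [Module (ZMod 2) M] [Module.Finite (ZMod 2) M]
    (h : Module.finrank (ZMod 2) M < Module.finrank (ZMod 2) V)
    (L : V →ₗ[ZMod 2] M) (G : M → ZMod 2) : ∑ v, G (L v) = 0 := by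
  obtain ⟨w, hw, hw0⟩ := (Submodule.ne_bot_iff _).1 (LinearMap.ker_ne_bot_of_finrank_lt (f := L) h)
  refine sum_eq_zero_of_translation _ w hw0 fun v => ?_
  rw [map_add, LinearMap.mem_ker.1 hw, add_zero]

section InverseSpace

variable {K : Type*} [Field K] [Fintype K] [Algebra (ZMod 2) K] [CharP K 2]

/-- The functional `x ↦ tr (c * x)`. -/
noncomputable def trMul (c : K) : K →ₗ[ZMod 2] ZMod 2 := tr ∘ₗ LinearMap.mulLeft (ZMod 2) c

theorem trMul_apply (c x : K) : trMul c x = tr (c * x) := rfl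

theorem sum_inv (f : K → ZMod 2) : ∑ u : K, f u⁻¹ = ∑ u, f u :=
  Function.Bijective.sum_comp (inv_involutive (G := K)).bijective f

theorem sum_tr_mul_tr (hn : 3 ≤ Module.finrank (ZMod 2) K) (x y : K) :
    ∑ u : K, tr (x * u) * tr (y * u) = 0 := by
  refine sum_comp_linearMap_eq_zero (M := ZMod 2 × ZMod 2) ?_ ((trMul x).prod (trMul y))
    (fun p => p.1 * p.2)
  rw [Module.finrank_prod, Module.finrank_self]; omega

theorem sum_tr_mul_tr_mul_tr (hn : 4 ≤ Module.finrank (ZMod 2) K) (x y z : K) :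
    ∑ u : K, tr (x * u) * tr (y * u) * tr (z * u) = 0 := by
  refine sum_comp_linearMap_eq_zero (M := ZMod 2 × ZMod 2 × ZMod 2) ?_
    ((trMul x).prod ((trMul y).prod (trMul z))) (fun p => p.1 * p.2.1 * p.2.2)
  rw [Module.finrank_prod, Module.finrank_prod, Module.finrank_self]; omega

theorem sum_kloosterman_pair (hn : 3 ≤ Module.finrank (ZMod 2) K) (x y x' y' : K) :
    ∑ u : K, tr (x * u + y * u⁻¹) * tr (x' * u + y' * u⁻¹) = tr (x * y' + x' * y) := by
  have h1 := sum_tr_mul_tr hn x x'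
  have h2 := sum_inv fun u => tr (y * u) * tr (y' * u)
  rw [sum_tr_mul_tr hn y y'] at h2
  have h3 := sum_tr_mul_tr_inv (by omega) x y'
  have h4 := sum_tr_mul_tr_inv (by omega) x' y
  rw [map_add, ← h3, ← h4]
  simp only [map_add, add_mul, mul_add, Finset.sum_add_distrib]
  rw [h1, h2, zero_add, add_zero, add_comm]
  congr 1
  exact Finset.sum_congr rfl fun u _ => mul_comm _ _

/-- Of the eight products, the two pure ones vanish because n ≥ 4 exceeds the number of functionals;
each mixed one is a carry term, after `u ↦ u⁻¹` where needed. -/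
theorem sum_kloosterman_triple (hn : 4 ≤ Module.finrank (ZMod 2) K) (x y x' y' x'' y'' : K) :
    ∑ u : K, tr (x * u + y * u⁻¹) * tr (x' * u + y' * u⁻¹) * tr (x'' * u + y'' * u⁻¹) =
      tr (x * x' * y'' ^ 2 + x * x'' * y' ^ 2 + x' * x'' * y ^ 2 +
        (y * y' * x'' ^ 2 + y * y'' * x' ^ 2 + y' * y'' * x ^ 2)) := by
  have h1 := sum_tr_mul_tr_mul_tr hn x x' x''
  have h2 := sum_inv fun u => tr (y * u) * tr (y' * u) * tr (y'' * u)
  rw [sum_tr_mul_tr_mul_tr hn y y' y''] at h2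
  have key : ∀ a b c : K, ∑ u : K, tr (a * u⁻¹) * tr (b * u⁻¹) * tr (c * u) =
      tr (a * b * c ^ 2) := by
    intro a b c
    have h := sum_inv fun u => tr (a * u⁻¹) * tr (b * u⁻¹) * tr (c * u)
    rw [← h, ← sum_tr_mul_tr_mul_tr_inv (by omega)]
    simp only [inv_inv]
  have h3 := sum_tr_mul_tr_mul_tr_inv (by omega) x x' y''
  have h4 := sum_tr_mul_tr_mul_tr_inv (by omega) x x'' y'
  have h5 := sum_tr_mul_tr_mul_tr_inv (by omega) x' x'' y
  simp only [map_add]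
  rw [← h3, ← h4, ← h5, ← key, ← key, ← key]
  have h6 : ∀ A B C A' B' C' : K → ZMod 2,
      ∑ u, (A u + A' u) * (B u + B' u) * (C u + C' u) =
      ∑ u, A u * B u * C u + ∑ u, A' u * B' u * C' u +
      (∑ u, A u * B u * C' u + ∑ u, A u * C u * B' u + ∑ u, B u * C u * A' u +
      (∑ u, A' u * B' u * C u + ∑ u, A' u * C' u * B u + ∑ u, B' u * C' u * A u)) := by
    intro A B C A' B' C'
    simp only [← Finset.sum_add_distrib]
    exact Finset.sum_congr rfl fun u _ => by ring
  rw [h6 (fun u => tr (x * u)) (fun u => tr (x' * u)) (fun u => tr (x'' * u))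
    (fun u => tr (y * u⁻¹)) (fun u => tr (y' * u⁻¹)) (fun u => tr (y'' * u⁻¹)), h1, h2]
  simp only [zero_add]

/-- The equation is the quadratic `x u² + s u + y = 0`; substituting `u = s r / x` puts it in
Artin–Schreier form. -/
theorem kloosterman_eq_iff {x y s r u : K} (hx : x ≠ 0) (hy : y ≠ 0) (hs : s ≠ 0)
    (hr : r ^ 2 + r = x * y * s⁻¹ ^ 2) :
    x * u + y * u⁻¹ = s ↔ u = s * r * x⁻¹ ∨ u = s * (r + 1) * x⁻¹ := by
  have hr' : (r ^ 2 + r) * s ^ 2 = x * y := by rw [hr]; field_simp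
  have hr0 : r ≠ 0 := by
    rintro rfl
    exact mul_ne_zero hx hy (by rw [← hr']; ring)
  have hr1 : r + 1 ≠ 0 := by
    intro h
    exact mul_ne_zero hx hy (by rw [← hr', show r ^ 2 + r = r * (r + 1) by ring, h]; ring)
  constructor
  · intro h
    have hu : u ≠ 0 := by rintro rfl; exact hs (by rw [← h]; simp)
    have h1 : x * u ^ 2 + y = s * u := by rw [← h]; field_simp
    have h2 : (x * u - s * r) * (x * u - s * (r + 1)) = 0 := by
      linear_combination x * h1 + hr' - s * u * x * r * CharTwo.two_eq_zero (R := K)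
    rcases mul_eq_zero.1 h2 with h3 | h3
    · left; field_simp; linear_combination h3
    · right; field_simp; linear_combination h3
  · rintro (rfl | rfl)
    · field_simp
      linear_combination - hr' + r ^ 2 * s ^ 2 * CharTwo.two_eq_zero (R := K)
    · field_simp
      linear_combination - hr' + (r ^ 2 + r) * s ^ 2 * CharTwo.two_eq_zero (R := K)

/-- The number of `u` with `tr (x * u + y * u⁻¹) = 1` is twice the number of `s` with
`tr s = 1` and `tr (x * y / s ^ 2) = 0`. -/
theorem card_tr_kloosterman_eq_one [DecidableEq K] (x y : K) (hx : x ≠ 0) (hy : y ≠ 0) :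
    (Finset.univ.filter fun u : K => tr (x * u + y * u⁻¹) = 1).card =
      2 * (Finset.univ.filter fun s : K => tr s = 1 ∧ tr (x * y * s⁻¹ ^ 2) = 0).card := by
  rw [Finset.card_eq_sum_card_fiberwise (f := fun u => x * u + y * u⁻¹)
    (t := Finset.univ.filter fun s : K => tr s = 1 ∧ tr (x * y * s⁻¹ ^ 2) = 0),
    Finset.sum_const_nat (m := 2), mul_comm]
  · intro s hs
    obtain ⟨hs1, hs2⟩ := (Finset.mem_filter.1 hs).2
    have hs0 : s ≠ 0 := by rintro rfl; simp at hs1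
    obtain ⟨r, hr⟩ := exists_sq_add_self hs2
    rw [Finset.filter_filter, Finset.card_eq_two]
    refine ⟨s * r * x⁻¹, s * (r + 1) * x⁻¹, fun h => ?_, ?_⟩
    · have : s * x⁻¹ = 0 := by linear_combination -h
      exact mul_ne_zero hs0 (inv_ne_zero hx) this
    · ext u
      simp only [Finset.mem_filter, Finset.mem_univ, true_and, Finset.mem_insert,
        Finset.mem_singleton]
      rw [← kloosterman_eq_iff hx hy hs0 hr]
      exact ⟨fun h => h.2, fun h => ⟨by rw [h, hs1], h⟩⟩
  · intro u hu
    have hu1 : tr (x * u + y * u⁻¹) = 1 := (Finset.mem_filter.1 hu).2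
    refine Finset.mem_coe.2 (Finset.mem_filter.2 ⟨Finset.mem_univ _, hu1, ?_⟩)
    have hu0 : u ≠ 0 := by rintro rfl; simp at hu1
    set s := x * u + y * u⁻¹ with hs
    have hs0 : s ≠ 0 := by rintro h; rw [h] at hu1; simp at hu1
    have h1 : x * u ^ 2 + y = s * u := by rw [hs]; field_simp
    have : x * y * s⁻¹ ^ 2 = (x * u * s⁻¹) ^ 2 + x * u * s⁻¹ := by
      field_simp
      linear_combination h1 - x * u ^ 2 * CharTwo.two_eq_zero (R := K)
    rw [this, map_add, tr_sq, CharTwo.add_self_eq_zero]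

/-- The count is `2 * T.card`, so a balanced function makes `T.card` even; modulo 2 that cardinality
is also `tr (rt (x * y)) = tr (x * y)`. -/
theorem tr_mul_eq_zero_of_card (hn : 4 ≤ Module.finrank (ZMod 2) K) (x y : K)
    (h : (Finset.univ.filter fun u : K => tr (x * u + y * u⁻¹) = 1).card =
      2 ^ (Module.finrank (ZMod 2) K - 1)) : tr (x * y) = 0 := by
  classical
  rcases eq_or_ne x 0 with rfl | hx
  · simp
  rcases eq_or_ne y 0 with rfl | hy
  · simp
  rw [card_tr_kloosterman_eq_one x y hx hy] at h
  set T := Finset.univ.filter fun s : K => tr s = 1 ∧ tr (x * y * s⁻¹ ^ 2) = 0 with hT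
  have h1 : (T.card : ZMod 2) = 0 := by
    obtain ⟨m, hm⟩ : ∃ m, Module.finrank (ZMod 2) K = m + 4 := ⟨_, (Nat.sub_add_cancel hn).symm⟩
    rw [hm, show m + 4 - 1 = m + 3 by omega, pow_succ', pow_succ'] at h
    have : T.card = 2 * 2 ^ (m + 1) := by omega
    rw [this, Nat.cast_mul]
    exact mul_eq_zero_of_left (by decide) _
  -- The two conditions defining `T` have indicators `tr s` and `1 + tr (rt (x * y) * s⁻¹)`.
  have h2 : (T.card : ZMod 2) = ∑ s : K, tr s * (1 + tr (rt (x * y) * s⁻¹)) := by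
    rw [hT, Finset.card_filter, Nat.cast_sum]
    refine Finset.sum_congr rfl fun s _ => ?_
    have : tr (x * y * s⁻¹ ^ 2) = tr (rt (x * y) * s⁻¹) := by
      rw [← tr_sq (rt (x * y) * s⁻¹), mul_pow, rt_sq]
    rw [this]
    generalize tr s = a
    generalize tr (rt (x * y) * s⁻¹) = b
    revert a b; decide
  have h3 : ∑ s : K, tr s = 0 := by
    have := sum_comp_linearMap_eq_zero (M := ZMod 2) (by rw [Module.finrank_self]; omega)
      (trMul (1 : K)) id
    simpa only [trMul_apply, one_mul, id] using this
  have h4 := sum_tr_mul_tr_inv (K := K) (by omega) 1 (rt (x * y))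
  simp only [one_mul, tr_rt] at h4
  rw [h1] at h2
  simp only [mul_add, mul_one, Finset.sum_add_distrib, h3, h4, zero_add] at h2
  exact h2.symm

/-- The properties of the `𝔽₂`-subspace `{(x, y) | a y = b x}` of `K × K` attached to a permutation
`u ↦ a u + b u⁻¹`. -/
structure IsInverseSpace (D : Submodule (ZMod 2) (K × K)) : Prop where
  finrank_eq : Module.finrank (ZMod 2) D = Module.finrank (ZMod 2) K
  tr_inv : ∀ x y : K, (x, y) ∈ D → x ≠ 0 → y ≠ 0 → tr (x * y)⁻¹ = 1
  tr_mul : ∀ x y : K, (x, y) ∈ D → tr (x * y) = 0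
  star_mem : ∀ x y x' y' : K, (x, y) ∈ D → (x', y') ∈ D →
    (x ^ 2 * y' + x' ^ 2 * y + rt (x * x'), y ^ 2 * x' + y' ^ 2 * x + rt (y * y')) ∈ D

theorem IsInverseSpace.orth {D : Submodule (ZMod 2) (K × K)} (hD : IsInverseSpace D)
    {x y x' y' : K} (h : (x, y) ∈ D) (h' : (x', y') ∈ D) : tr (x * y' + x' * y) = 0 := by
  have h1 := hD.tr_mul _ _ (D.add_mem h h')
  have h2 := hD.tr_mul _ _ h
  have h3 := hD.tr_mul _ _ h'
  have : (x + x') * (y + y') = x * y + x' * y' + (x * y' + x' * y) := by ring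
  rwa [this, map_add, map_add, h2, h3, zero_add, zero_add] at h1

/-- The subspace `{(x, y) | a y + b x = 0}`. -/
def inverseSpace (a b : K →ₗ[ZMod 2] K) : Submodule (ZMod 2) (K × K) :=
  LinearMap.ker (a ∘ₗ LinearMap.snd (ZMod 2) K K + b ∘ₗ LinearMap.fst (ZMod 2) K K)

theorem mem_inverseSpace {a b : K →ₗ[ZMod 2] K} {x y : K} :
    (x, y) ∈ inverseSpace a b ↔ a y + b x = 0 := by
  simp [inverseSpace]

theorem finrank_inverseSpace {a b : K →ₗ[ZMod 2] K}
    (hπ : Function.Bijective fun u => a u + b u⁻¹) :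
    Module.finrank (ZMod 2) (inverseSpace a b) = Module.finrank (ZMod 2) K := by
  have h := LinearMap.finrank_range_add_finrank_ker
    (a ∘ₗ LinearMap.snd (ZMod 2) K K + b ∘ₗ LinearMap.fst (ZMod 2) K K)
  have h1 : LinearMap.range
      (a ∘ₗ LinearMap.snd (ZMod 2) K K + b ∘ₗ LinearMap.fst (ZMod 2) K K) = ⊤ := by
    rw [LinearMap.range_eq_top]
    intro w
    obtain ⟨u, hu⟩ := hπ.2 w
    exact ⟨(u⁻¹, u), by simpa using hu⟩
  rw [h1, finrank_top, Module.finrank_prod] at h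
  unfold inverseSpace
  omega

/-- Otherwise `r² + r = (x y)⁻¹` is solvable, and `y r`, `y (r + 1)` have sum `y` and inverses of
sum `x`. Since `a y + b x = 0`, they collide under the permutation. -/
theorem tr_inv_of_mem_inverseSpace {a b : K →ₗ[ZMod 2] K}
    (hπ : Function.Bijective fun u => a u + b u⁻¹) {x y : K} (h : (x, y) ∈ inverseSpace a b)
    (hx : x ≠ 0) (hy : y ≠ 0) : tr (x * y)⁻¹ = 1 := by
  rw [mem_inverseSpace] at h
  by_contra hne
  obtain ⟨r, hr⟩ := exists_sq_add_self (zmod_two_ne_one.1 hne)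
  have hxy := inv_ne_zero (mul_ne_zero hx hy)
  have hr' : r * (r + 1) ≠ 0 := by rw [← hr] at hxy; convert hxy using 1; ring
  have hr0 := left_ne_zero_of_mul hr'
  have hr1 := right_ne_zero_of_mul hr'
  have h2 := CharTwo.two_eq_zero (R := K)
  have hr2 : (r ^ 2 + r) * (x * y) = 1 := by rw [hr]; field_simp
  have h3 : (y * r)⁻¹ + (y * (r + 1))⁻¹ = x := by
    field_simp
    linear_combination -hr2 + r * h2
  have h4 : y * r + y * (r + 1) = y := by linear_combination y * r * h2
  have h5 : y * r = y * (r + 1) := by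
    apply hπ.1
    have : a (y * r) + a (y * (r + 1)) + (b (y * r)⁻¹ + b (y * (r + 1))⁻¹) = 0 := by
      rw [← map_add, ← map_add, h3, h4, h]
    change a (y * r) + b (y * r)⁻¹ = a (y * (r + 1)) + b (y * (r + 1))⁻¹
    rw [← CharTwo.add_eq_zero, ← this]
    ring
  exact hy (by linear_combination -h5)

theorem exists_adjoint (a : K →ₗ[ZMod 2] K) (v : K) : ∃ c : K, ∀ u, tr (v * a u) = tr (c * u) :=
  exists_tr_mul_eq (trMul v ∘ₗ a)

theorem card_trMul_eq_one [DecidableEq K] {v : K} (hv : v ≠ 0) :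
    (Finset.univ.filter fun u : K => trMul v u = 1).card =
      2 ^ (Module.finrank (ZMod 2) K - 1) := by
  obtain ⟨x, hx⟩ := exists_tr_eq_one (K := K)
  have hx' : trMul v (v⁻¹ * x) = 1 := by rw [trMul_apply, mul_inv_cancel_left₀ hv, hx]
  have h1 : (Finset.univ.filter fun u : K => trMul v u = 1).card =
      (Finset.univ.filter fun u : K => ¬ trMul v u = 1).card := by
    refine Finset.card_bij (fun u _ => u + v⁻¹ * x) (fun u hu => ?_)
      (fun u _ w _ h => add_right_cancel h) fun z hz => ⟨z + v⁻¹ * x, ?_, ?_⟩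
    · rw [Finset.mem_filter] at hu ⊢
      rw [map_add, hu.2, hx']
      exact ⟨Finset.mem_univ _, by decide⟩
    · rw [Finset.mem_filter] at hz ⊢
      rw [map_add, zmod_two_ne_one.1 hz.2, hx']
      exact ⟨Finset.mem_univ _, by decide⟩
    · rw [add_assoc, CharTwo.add_self_eq_zero, add_zero]
  have h2 := Finset.card_filter_add_card_filter_not (s := Finset.univ)
    (fun u : K => trMul v u = 1)
  rw [← h1, Finset.card_univ, card_eq_two_pow] at h2
  have h3 := Module.finrank_pos (R := ZMod 2) (M := K)
  obtain ⟨m, hm⟩ : ∃ m, Module.finrank (ZMod 2) K = m + 1 := ⟨_, (Nat.sub_add_cancel h3).symm⟩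
  rw [hm, pow_succ] at h2
  rw [hm, Nat.add_sub_cancel]
  omega

/-- With trace adjoints `α`, `β`, the function `tr (α v * u + β v * u⁻¹)` is `tr (v * z)` for the
permuted variable z, so its moments are those of linear functionals. Second moments place `(α v, β
v)` in the space, and dimension shows that every element has this form; balancedness and third
moments then give `tr_mul` and `star_mem`. -/
theorem isInverseSpace_of_bijective (hn : 4 ≤ Module.finrank (ZMod 2) K) {a b : K →ₗ[ZMod 2] K}
    (hπ : Function.Bijective fun u => a u + b u⁻¹) : IsInverseSpace (inverseSpace a b) := by
  classical
  choose α hα using exists_adjoint a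
  choose β hβ using exists_adjoint b
  have hαβ : ∀ v u, tr (α v * u + β v * u⁻¹) = tr (v * (a u + b u⁻¹)) := fun v u => by
    rw [map_add, ← hα, ← hβ, ← map_add, mul_add]
  have hsum : ∀ f : K → ZMod 2, ∑ u, f (a u + b u⁻¹) = ∑ u, f u := fun f => hπ.sum_comp f
  have horth : ∀ v w, tr (α v * β w + α w * β v) = 0 := fun v w => by
    rw [← sum_kloosterman_pair (by omega)]
    simp only [hαβ]
    rw [hsum fun z => tr (v * z) * tr (w * z)]
    exact sum_tr_mul_tr (by omega) v w
  have hmem : ∀ v, (α v, β v) ∈ inverseSpace a b := fun v => by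
    rw [mem_inverseSpace]
    refine eq_zero_of_tr_mul fun w => ?_
    rw [mul_comm, mul_add, map_add, hα, hβ, ← map_add, ← horth w v, mul_comm (β w)]
  have hinj : Function.Injective fun v => (⟨(α v, β v), hmem v⟩ : inverseSpace a b) := by
    intro v w h
    have h1 : α v = α w := congrArg (fun p => p.1.1) h
    have h2 : β v = β w := congrArg (fun p => p.1.2) h
    rw [← sub_eq_zero]
    refine eq_zero_of_tr_mul fun z => ?_
    obtain ⟨u, rfl⟩ := hπ.2 z
    have := (hαβ v u).symm.trans ((by rw [h1, h2] : _ = tr (α w * u + β w * u⁻¹)).trans (hαβ w u))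
    rw [sub_mul, map_sub, sub_eq_zero]
    exact this
  have hcard : Nat.card K = Nat.card (inverseSpace a b) := by
    rw [Module.natCard_eq_pow_finrank (K := ZMod 2),
      Module.natCard_eq_pow_finrank (K := ZMod 2) (V := inverseSpace a b), finrank_inverseSpace hπ]
  have hsurj := ((Nat.bijective_iff_injective_and_card _).2 ⟨hinj, hcard⟩).2
  have hex : ∀ x y, (x, y) ∈ inverseSpace a b → ∃ v, α v = x ∧ β v = y := fun x y h => by
    obtain ⟨v, hv⟩ := hsurj ⟨(x, y), h⟩
    exact ⟨v, congrArg (fun p => p.1.1) hv, congrArg (fun p => p.1.2) hv⟩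
  refine ⟨finrank_inverseSpace hπ, fun x y h => tr_inv_of_mem_inverseSpace hπ h, ?_, ?_⟩
  · intro x y h
    obtain ⟨v, rfl, rfl⟩ := hex x y h
    rcases eq_or_ne v 0 with rfl | hv
    · have : β 0 = 0 := eq_zero_of_tr_mul fun u => by rw [← hβ]; simp
      rw [this]; simp
    refine tr_mul_eq_zero_of_card hn _ _ ?_
    simp only [hαβ]
    rw [← card_trMul_eq_one hv]
    exact Finset.card_bij (fun u _ => a u + b u⁻¹) (fun u hu => Finset.mem_filter.2
      ⟨Finset.mem_univ _, (Finset.mem_filter.1 hu).2⟩) (fun u _ w _ h => hπ.1 h) fun z hz => by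
        obtain ⟨u, rfl⟩ := hπ.2 z
        exact ⟨u, Finset.mem_filter.2 ⟨Finset.mem_univ _, (Finset.mem_filter.1 hz).2⟩, rfl⟩
  · intro x y x' y' h h'
    obtain ⟨v, rfl, rfl⟩ := hex x y h
    obtain ⟨w, rfl, rfl⟩ := hex x' y' h'
    rw [mem_inverseSpace]
    refine eq_zero_of_tr_mul fun z => ?_
    have h1 := sum_kloosterman_triple hn (α v) (β v) (α w) (β w) (α z) (β z)
    simp only [hαβ] at h1
    rw [hsum fun t => tr (v * t) * tr (w * t) * tr (z * t), sum_tr_mul_tr_mul_tr hn] at h1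
    rw [mul_comm, mul_add, map_add, hα, hβ, ← map_add]
    have e1 : tr (α z * rt (β v * β w)) = tr (β v * β w * α z ^ 2) := by
      rw [← tr_sq, mul_pow, rt_sq, mul_comm]
    have e2 : tr (β z * rt (α v * α w)) = tr (α v * α w * β z ^ 2) := by
      rw [← tr_sq, mul_pow, rt_sq, mul_comm]
    simp only [mul_add, map_add] at h1 ⊢
    rw [e1, e2, h1]
    rw [show α z * (β v ^ 2 * α w) = α w * α z * β v ^ 2 by ring,
      show α z * (β w ^ 2 * α v) = α v * α z * β w ^ 2 by ring,
      show β z * (α v ^ 2 * β w) = β w * β z * α v ^ 2 by ring,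
      show β z * (α w ^ 2 * β v) = β v * β z * α w ^ 2 by ring]
    abel

end InverseSpace

/-! ### Coordinate exchange and scaling of inverse spaces. -/

section Symmetries

variable {K : Type*} [Field K] [Fintype K] [Algebra (ZMod 2) K] [CharP K 2]

variable {D : Submodule (ZMod 2) (K × K)}

theorem IsInverseSpace.exists_mem_of_snd (hD : IsInverseSpace D)
    (h : ∀ x, (x, (0 : K)) ∈ D → x = 0) (y : K) : ∃ x, (x, y) ∈ D := by
  let f : D →ₗ[ZMod 2] K := LinearMap.snd (ZMod 2) K K ∘ₗ D.subtype
  have hf : Function.Injective f := by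
    rw [← LinearMap.ker_eq_bot, LinearMap.ker_eq_bot']
    rintro ⟨⟨x, y⟩, hm⟩ (hy : y = 0)
    subst hy
    rw [Submodule.mk_eq_zero, h x hm]
    rfl
  have hs := (LinearMap.injective_iff_surjective_of_finrank_eq_finrank hD.finrank_eq).1 hf
  obtain ⟨⟨⟨x, y'⟩, hm⟩, rfl⟩ := hs y
  exact ⟨x, hm⟩

/-- The image of a subspace of `K × K` under the exchange of coordinates. -/
def swapSpace (D : Submodule (ZMod 2) (K × K)) : Submodule (ZMod 2) (K × K) :=
  D.map (LinearEquiv.prodComm (ZMod 2) K K).toLinearMap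

theorem mem_swapSpace {x y : K} : (x, y) ∈ swapSpace D ↔ (y, x) ∈ D := by
  simp [swapSpace]

theorem IsInverseSpace.swapSpace (hD : IsInverseSpace D) : IsInverseSpace (swapSpace D) where
  finrank_eq := by
    rw [← hD.finrank_eq]
    exact LinearEquiv.finrank_map_eq _ _
  tr_inv x y h hx hy := by
    rw [mul_comm]; exact hD.tr_inv y x (mem_swapSpace.1 h) hy hx
  tr_mul x y h := by
    rw [mul_comm]; exact hD.tr_mul y x (mem_swapSpace.1 h)
  star_mem x y x' y' h h' :=
    mem_swapSpace.2 (hD.star_mem y x y' x' (mem_swapSpace.1 h) (mem_swapSpace.1 h'))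

/-- The image of a subspace of `K × K` under `(x, y) ↦ (μ x, μ⁻¹ y)`. -/
def scaleSpace (μ : Kˣ) (D : Submodule (ZMod 2) (K × K)) : Submodule (ZMod 2) (K × K) :=
  D.map ((μ.mulLeftLinearEquiv (ZMod 2) K).prodCongr
    (μ⁻¹.mulLeftLinearEquiv (ZMod 2) K)).toLinearMap

theorem mem_scaleSpace {μ : Kˣ} {x y : K} :
    (x, y) ∈ scaleSpace μ D ↔ ((μ : K)⁻¹ * x, (μ : K) * y) ∈ D := by
  rw [scaleSpace, Submodule.mem_map]
  constructor
  · rintro ⟨⟨x', y'⟩, h, h'⟩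
    have h1 : (μ : K) * x' = x := congrArg Prod.fst h'
    have h2 : ((μ⁻¹ : Kˣ) : K) * y' = y := congrArg Prod.snd h'
    rw [← h1, ← h2]
    simpa using h
  · intro h
    refine ⟨_, h, Prod.ext ?_ ?_⟩
    · change (μ : K) * ((μ : K)⁻¹ * x) = x
      simp
    · change ((μ⁻¹ : Kˣ) : K) * ((μ : K) * y) = y
      simp

theorem IsInverseSpace.scaleSpace (hD : IsInverseSpace D) (μ : Kˣ) :
    IsInverseSpace (scaleSpace μ D) where
  finrank_eq := by
    rw [← hD.finrank_eq]
    exact LinearEquiv.finrank_map_eq _ _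
  tr_inv x y h hx hy := by
    have := hD.tr_inv _ _ (mem_scaleSpace.1 h) (by simp [hx]) (by simp [hy])
    rwa [show (μ : K)⁻¹ * x * (μ * y) = x * y by field_simp] at this
  tr_mul x y h := by
    have := hD.tr_mul _ _ (mem_scaleSpace.1 h)
    rwa [show (μ : K)⁻¹ * x * (μ * y) = x * y by field_simp] at this
  star_mem x y x' y' h h' := by
    have := hD.star_mem _ _ _ _ (mem_scaleSpace.1 h) (mem_scaleSpace.1 h')
    rw [mem_scaleSpace]
    have e1 : rt ((μ : K)⁻¹ * x * ((μ : K)⁻¹ * x')) = (μ : K)⁻¹ * rt (x * x') := by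
      rw [show (μ : K)⁻¹ * x * ((μ : K)⁻¹ * x') = (μ : K)⁻¹ ^ 2 * (x * x') by ring, map_mul,
        rt_sq']
    have e2 : rt ((μ : K) * y * ((μ : K) * y')) = (μ : K) * rt (y * y') := by
      rw [show (μ : K) * y * ((μ : K) * y') = (μ : K) ^ 2 * (y * y') by ring, map_mul, rt_sq']
    rw [e1, e2] at this
    convert this using 2
    · field_simp
    · field_simp

end Symmetries

/-! ### Spaces containing nonzero points of both axes. -/

section BothAxes

variable {K : Type*} [Field K] [Fintype K] [Algebra (ZMod 2) K] [CharP K 2]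

variable {D : Submodule (ZMod 2) (K × K)}

/-- A scalar that preserves a finite set of `m` nonzero elements is an `m`-th root of unity. -/
theorem pow_card_eq_one_of_mul_mem {L : Type*} [Field L] (S : Finset L) (l : L)
    (hl : l ≠ 0) (h0 : (0 : L) ∉ S) (hS : ∀ s ∈ S, l * s ∈ S) : l ^ S.card = 1 := by
  classical
  have himg : S.image (l * ·) = S := by
    refine Finset.eq_of_subset_of_card_le (Finset.image_subset_iff.2 hS) ?_
    rw [Finset.card_image_of_injective _ (mul_right_injective₀ hl)]
  have h1 : ∏ s ∈ S, l * s = ∏ s ∈ S, s := by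
    conv_rhs => rw [← himg, Finset.prod_image fun a _ b _ h => mul_right_injective₀ hl h]
  rw [Finset.prod_mul_distrib, Finset.prod_const] at h1
  exact mul_eq_right₀ (Finset.prod_ne_zero_iff.2 fun s hs h => h0 (h ▸ hs)) |>.1 h1

theorem exists_algebraMap_eq_of_pow_card_eq {L : Type*} [Field L] [Algebra K L] {l : L}
    (hl : l ^ Fintype.card K = l) : ∃ a : K, algebraMap K L a = l := by
  classical
  have hq : 1 < Fintype.card K := Fintype.one_lt_card
  have hne := FiniteField.X_pow_card_sub_X_ne_zero L hq
  have hmem : ∀ z : L, z ∈ (Polynomial.X ^ Fintype.card K - Polynomial.X :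
      Polynomial L).roots.toFinset ↔ z ^ Fintype.card K = z := by
    intro z
    rw [Multiset.mem_toFinset, Polynomial.mem_roots hne]
    simp [sub_eq_zero]
  have hsub : Finset.univ.image (algebraMap K L) ⊆ (Polynomial.X ^ Fintype.card K -
      Polynomial.X : Polynomial L).roots.toFinset := by
    refine Finset.image_subset_iff.2 fun a _ => ?_
    rw [hmem, ← map_pow, FiniteField.pow_card]
  have heq := Finset.eq_of_subset_of_card_le hsub (by
    rw [Finset.card_image_of_injective _ (algebraMap K L).injective, Finset.card_univ]
    refine (Multiset.toFinset_card_le _).trans ((Polynomial.card_roots' _).trans ?_)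
    rw [FiniteField.X_pow_card_sub_X_natDegree_eq L hq])
  rw [← hmem, ← heq, Finset.mem_image] at hl
  obtain ⟨a, -, ha⟩ := hl
  exact ⟨a, ha⟩

theorem IsInverseSpace.star_zero_one (hD : IsInverseSpace D) (h1 : ((0 : K), (1 : K)) ∈ D)
    {x y : K} (h : (x, y) ∈ D) : (x ^ 2, x + rt y) ∈ D := by
  simpa using hD.star_mem _ _ _ _ h h1

theorem IsInverseSpace.not_mem_axes_aux (L : Type*) [Field L] [Algebra K L] [IsAlgClosed L]
    (hD : IsInverseSpace D) (h1 : ((0 : K), (1 : K)) ∈ D)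
    {w : K} (hw : (w, (0 : K)) ∈ D) : w = 0 := by
  classical
  by_contra hw0
  -- Multiply by `(w, 0)`, then by `(0, 1)`. In the coordinates `(x, y²)` the composite is
  -- `K`-linear with rows `(w, w⁴)` and `(w, w⁴ + w)`, so its characteristic polynomial is `l² + w⁴
  -- l + w²`.
  have hstep : ∀ x y, (x, y) ∈ D →
      (w * x + w ^ 4 * y ^ 2, (w ^ 2 + rt w) * y + rt (w * x)) ∈ D := by
    intro x y h
    have h2 := hD.star_zero_one h1 (hD.star_mem _ _ _ _ h hw)
    convert h2 using 2
    · simp only [mul_zero, zero_add, add_pow_char, mul_pow, rt_sq]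
      ring
    · simp only [mul_zero, map_zero, ne_eq, OfNat.ofNat_ne_zero, not_false_eq_true, zero_pow,
        zero_mul, add_zero, zero_add, map_mul, rt_sq']
      ring
  have : CharP L 2 := charP_of_injective_algebraMap (algebraMap K L).injective 2
  have h2 := CharTwo.two_eq_zero (R := L)
  let W : L := algebraMap K L w
  have hW : W ≠ 0 := (map_ne_zero _).2 hw0
  obtain ⟨l, hl⟩ : ∃ l : L, l ^ 2 + W ^ 4 * l + W ^ 2 = 0 := by
    obtain ⟨l, hl⟩ := IsAlgClosed.exists_root (Polynomial.X ^ 2 + Polynomial.C (W ^ 4) *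
      Polynomial.X + Polynomial.C (W ^ 2) : Polynomial L) (by
        rw [show Polynomial.degree _ = 2 by compute_degree!]
        decide)
    exact ⟨l, by simpa using hl⟩
  -- A root `a` in `K` would write `w⁻⁶` as `z² + z` with `z = a / w⁴`, contradicting `tr_inv` at
  -- the point `(w², w)` of `D`.
  have hlK : ∀ a : K, algebraMap K L a ≠ l := by
    rintro a rfl
    have hl' : a ^ 2 + w ^ 4 * a + w ^ 2 = 0 := by
      apply (algebraMap K L).injective
      simpa using hl
    have h3 : (w ^ 2, w) ∈ D := by simpa using hD.star_mem _ _ _ _ hw h1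
    have h4 := hD.tr_inv _ _ h3 (pow_ne_zero 2 hw0) hw0
    have h5 : ((w ^ 2 * w)⁻¹) ^ 2 = (a * w⁻¹ ^ 4) ^ 2 + a * w⁻¹ ^ 4 := by
      field_simp
      linear_combination hl' - (a ^ 2 + w ^ 4 * a) * CharTwo.two_eq_zero (R := K)
    rw [← tr_sq, h5, map_add, tr_sq, CharTwo.add_self_eq_zero] at h4
    exact zero_ne_one h4
  -- A left eigenvector for `l`; it is injective because `l` is not in `K`.
  let ι : K × K → L := fun p => W * algebraMap K L p.1 + (l + W) * algebraMap K L p.2 ^ 2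
  have hι : ∀ x y, ι (w * x + w ^ 4 * y ^ 2, (w ^ 2 + rt w) * y + rt (w * x)) = l * ι (x, y) := by
    intro x y
    have e : ((w ^ 2 + rt w) * y + rt (w * x)) ^ 2 = (w ^ 4 + w) * y ^ 2 + w * x := by
      simp only [add_pow_char, mul_pow, rt_sq]; ring
    simp only [ι, ← map_pow, e]
    simp only [map_add, map_mul, map_pow]
    change W * (W * _ + W ^ 4 * _) + (l + W) * ((W ^ 4 + W) * _ + W * _) = _
    linear_combination (-algebraMap K L y ^ 2) * hl + (W * W * algebraMap K L x + (W ^ 5 + W ^ 4 * l + W ^ 2) * algebraMap K L y ^ 2) * h2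
  have hιinj : ∀ x y, ι (x, y) = 0 → x = 0 ∧ y = 0 := by
    intro x y h
    have h' : W * algebraMap K L x + (l + W) * algebraMap K L y ^ 2 = 0 := h
    have hy : y = 0 := by
      by_contra hy
      have hy' : algebraMap K L y ≠ 0 := (map_ne_zero _).2 hy
      refine hlK (w * x * y⁻¹ ^ 2 + w) ?_
      simp only [map_add, map_mul, map_pow, map_inv₀]
      change W * algebraMap K L x * (algebraMap K L y)⁻¹ ^ 2 + W = l
      field_simp
      linear_combination h' - l * algebraMap K L y ^ 2 * h2
    subst hy
    simp only [map_zero, ne_eq, OfNat.ofNat_ne_zero, not_false_eq_true, zero_pow, mul_zero,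
      add_zero, mul_eq_zero, hW, false_or, map_eq_zero] at h'
    exact ⟨h', rfl⟩
  have hl0 : l ≠ 0 := by
    have := hlK 0
    rw [map_zero] at this
    exact this.symm
  have := Fintype.ofFinite D
  let S : Finset L := (Finset.univ.filter fun p : D => p ≠ 0).image fun p : D => ι p.1
  have hιadd : ∀ p q : K × K, ι (p - q) = ι p - ι q := by
    intro p q
    simp only [ι, Prod.fst_sub, Prod.snd_sub, map_sub, sub_pow_char]
    ring
  have hS : S.card = Fintype.card K - 1 := by
    rw [Finset.card_image_of_injective, Finset.filter_ne', Finset.card_erase_of_mem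
      (Finset.mem_univ _), Finset.card_univ, ← Nat.card_eq_fintype_card,
      Module.natCard_eq_pow_finrank (K := ZMod 2), hD.finrank_eq, card_eq_two_pow, Nat.card_zmod]
    intro p q hpq
    have h3 := hιadd p q
    rw [sub_eq_zero.2 hpq] at h3
    obtain ⟨h4, h5⟩ := hιinj _ _ h3
    exact Subtype.ext (Prod.ext (sub_eq_zero.1 h4) (sub_eq_zero.1 h5))
  -- `S` is the image of the nonzero elements of `D` and has `Fintype.card K - 1` elements, so `l`
  -- is a root of unity of that order and lies in `K`.
  have hpow := pow_card_eq_one_of_mul_mem S l hl0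
    (by
      intro h0
      obtain ⟨⟨⟨x, y⟩, hp⟩, hp0, h0⟩ := Finset.mem_image.1 h0
      obtain ⟨rfl, rfl⟩ := hιinj _ _ h0
      exact (Finset.mem_filter.1 hp0).2 rfl)
    (by
      intro s hs
      obtain ⟨⟨⟨x, y⟩, hp⟩, hp0, rfl⟩ := Finset.mem_image.1 hs
      refine Finset.mem_image.2 ⟨⟨_, hstep x y hp⟩, Finset.mem_filter.2 ⟨Finset.mem_univ _, ?_⟩,
        hι x y⟩
      intro h
      have h3 := hι x y
      have h4 : ι (w * x + w ^ 4 * y ^ 2, (w ^ 2 + rt w) * y + rt (w * x)) = 0 := by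
        rw [show (w * x + w ^ 4 * y ^ 2, (w ^ 2 + rt w) * y + rt (w * x)) = (0 : K × K) from
          congrArg Subtype.val h]
        simp [ι]
      rw [h4] at h3
      obtain ⟨rfl, rfl⟩ := hιinj _ _ ((mul_eq_zero.1 h3.symm).resolve_left hl0)
      exact (Finset.mem_filter.1 hp0).2 rfl)
  rw [hS] at hpow
  obtain ⟨a, ha⟩ := exists_algebraMap_eq_of_pow_card_eq (K := K) (l := l) (by
    rw [← Nat.sub_add_cancel (Fintype.card_pos (α := K)), pow_succ, hpow, one_mul])
  exact hlK a ha

theorem IsInverseSpace.not_mem_axes (hD : IsInverseSpace D) (h1 : ((0 : K), (1 : K)) ∈ D)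
    {w : K} (hw : (w, (0 : K)) ∈ D) : w = 0 :=
  hD.not_mem_axes_aux (AlgebraicClosure K) h1 hw

end BothAxes

/-! ### Spaces meeting neither axis. -/

/-- In the Leibniz formula the terms of `σ` and `σ⁻¹` cancel. An involution of an odd set has a
fixed point, so its term contains a zero diagonal entry. -/
theorem det_eq_zero_of_alternating {n : ℕ} (hn : Odd n) (M : Matrix (Fin n) (Fin n) (ZMod 2))
    (hsymm : ∀ i j, M i j = M j i) (hdiag : ∀ i, M i i = 0) : M.det = 0 := by
  rw [Matrix.det_apply]
  refine Finset.sum_involution (fun σ _ => σ⁻¹) (fun σ _ => ?_) (fun σ _ hσ h => hσ ?_)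
    (fun σ _ => Finset.mem_univ _) (fun σ _ => inv_inv σ)
  · have : ∏ i, M (σ⁻¹ i) i = ∏ i, M (σ i) i := by
      rw [← Equiv.prod_comp σ]
      refine Finset.prod_congr rfl fun i _ => ?_
      rw [show σ⁻¹ (σ i) = i from σ.symm_apply_apply i, hsymm]
    rw [this, Equiv.Perm.sign_inv, CharTwo.add_self_eq_zero]
  · have hfix : ∃ i, σ i = i := by
      refine Equiv.Perm.exists_fixed_point_of_prime (p := 2) (n := 1) ?_ ?_
      · rw [Fintype.card_fin]
        exact hn.not_two_dvd_nat
      · rw [pow_one, pow_two]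
        nth_rw 1 [← h]
        exact inv_mul_cancel σ
    obtain ⟨i, hi⟩ := hfix
    rw [Finset.prod_eq_zero (Finset.mem_univ i) (by rw [hi, hdiag]), smul_zero]

/-- Fewer than `n / 2` quadratic forms in `n` variables over `𝔽₂` have a nontrivial zero. -/
theorem exists_common_zero {n m : ℕ} (h : 2 * m < n)
    (B : Fin m → Fin n → Fin n → ZMod 2) :
    ∃ v : Fin n → ZMod 2, v ≠ 0 ∧ ∀ j, ∑ i, ∑ k, B j i k * (v i * v k) = 0 := by
  classical
  let f : Fin m → MvPolynomial (Fin n) (ZMod 2) := fun j =>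
    ∑ i, ∑ k, MvPolynomial.C (B j i k) * (MvPolynomial.X i * MvPolynomial.X k)
  have hf : ∀ j, (f j).totalDegree ≤ 2 := fun j => by
    refine MvPolynomial.totalDegree_finsetSum_le fun i _ =>
      MvPolynomial.totalDegree_finsetSum_le fun k _ => ?_
    refine (MvPolynomial.totalDegree_mul _ _).trans ?_
    rw [MvPolynomial.totalDegree_C, zero_add]
    refine (MvPolynomial.totalDegree_mul _ _).trans ?_
    rw [MvPolynomial.totalDegree_X, MvPolynomial.totalDegree_X]
  have hsum : ∑ j, (f j).totalDegree < Fintype.card (Fin n) := by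
    rw [Fintype.card_fin]
    refine lt_of_le_of_lt (Finset.sum_le_sum fun j _ => hf j) ?_
    simpa [mul_comm] using h
  have hdvd := char_dvd_card_solutions_of_fintype_sum_lt 2 hsum
  have heval : ∀ j v, MvPolynomial.eval v (f j) = ∑ i, ∑ k, B j i k * (v i * v k) := by
    intro j v
    simp [f, map_sum]
  simp only [heval] at hdvd
  by_contra! hne
  have : Fintype.card {v : Fin n → ZMod 2 // ∀ j, ∑ i, ∑ k, B j i k * (v i * v k) = 0} = 1 := by
    rw [Fintype.card_eq_one_iff]
    refine ⟨⟨0, by simp⟩, fun ⟨v, hv⟩ => Subtype.ext ?_⟩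
    by_contra hv0
    obtain ⟨j, hj⟩ := hne v hv0
    exact hj (hv j)
  rw [this] at hdvd
  omega

section NoAxis

variable {K : Type*} [Field K] [Fintype K] [Algebra (ZMod 2) K] [CharP K 2]

variable {D : Submodule (ZMod 2) (K × K)}

@[simp]
theorem tr_pow_two_pow (x : K) (j : ℕ) : tr (x ^ 2 ^ j) = tr x := by
  induction j with
  | zero => simp
  | succ j ih => rw [pow_succ, pow_mul, tr_sq, ih]

/-- The conjugation of a quadratic extension is self-adjoint for the trace form. -/
theorem tr_mul_conj {m : ℕ} (hm : Module.finrank (ZMod 2) K = 2 * m) (c z : K) :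
    tr (c * z ^ 2 ^ m) = tr (c ^ 2 ^ m * z) := by
  rw [← tr_pow_two_pow (c * z ^ 2 ^ m) m, mul_pow, ← pow_mul, ← pow_add, ← two_mul, ← hm,
    pow_two_pow_finrank]

theorem conj_conj {m : ℕ} (hm : Module.finrank (ZMod 2) K = 2 * m) (c : K) :
    (c ^ 2 ^ m) ^ 2 ^ m = c := by
  rw [← pow_mul, ← pow_add, ← two_mul, ← hm, pow_two_pow_finrank]

theorem tr_eq_zero_of_conj_eq {m : ℕ} (hm : Module.finrank (ZMod 2) K = 2 * m) {u : K}
    (hu : u ^ 2 ^ m = u) : tr u = 0 := by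
  apply (algebraMap (ZMod 2) K).injective
  rw [algebraMap_tr, hm, two_mul, Finset.sum_range_add, map_zero, ← CharTwo.add_self_eq_zero
    (∑ i ∈ Finset.range m, u ^ 2 ^ i)]
  congr 1
  refine Finset.sum_congr rfl fun i _ => ?_
  rw [pow_add, pow_mul, hu]

/-- The fixed field of the conjugation, as a subspace. -/
def fixedSpace (K : Type*) [Field K] [Algebra (ZMod 2) K] [CharP K 2] (m : ℕ) :
    Submodule (ZMod 2) K where
  carrier := {e | e ^ 2 ^ m = e}
  add_mem' {a b} ha hb := by
    change (a + b) ^ 2 ^ m = a + b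
    rw [add_pow_char_pow, ha, hb]
  zero_mem' := zero_pow (by positivity)
  smul_mem' c x hx := by
    rcases zmod_two_cases c with rfl | rfl
    · rw [zero_smul]; exact zero_pow (by positivity)
    · rwa [one_smul]

theorem mem_fixedSpace {m : ℕ} {e : K} : e ∈ fixedSpace K m ↔ e ^ 2 ^ m = e := Iff.rfl

theorem finrank_fixedSpace_le {m : ℕ} (hm : 0 < m) :
    Module.finrank (ZMod 2) (fixedSpace K m) ≤ m := by
  classical
  have h1 : 1 < 2 ^ m := Nat.one_lt_two_pow hm.ne'
  have hne := FiniteField.X_pow_card_sub_X_ne_zero K h1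
  have h2 : Nat.card (fixedSpace K m) ≤ 2 ^ m := by
    have hle : (fixedSpace K m : Set K) ⊆
        ((Polynomial.X ^ 2 ^ m - Polynomial.X : Polynomial K).roots.toFinset : Set K) := by
      intro e (he : e ^ 2 ^ m = e)
      rw [Finset.mem_coe, Multiset.mem_toFinset, Polynomial.mem_roots hne]
      simp [he]
    have h3 := Set.ncard_le_ncard hle
    rw [Set.ncard_coe_finset] at h3
    refine h3.trans ((Multiset.toFinset_card_le _).trans ((Polynomial.card_roots' _).trans ?_))
    rw [FiniteField.X_pow_card_sub_X_natDegree_eq K h1]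
  rw [Module.natCard_eq_pow_finrank (K := ZMod 2), Nat.card_zmod] at h2
  exact (Nat.pow_le_pow_iff_right (by norm_num)).1 h2

/-- Pairing `z` with `c + c ^ 2 ^ m`, which lies in the fixed field, equals pairing `c` with `z + z
^ 2 ^ m`; nondegeneracy finishes. -/
theorem conj_eq_of_orth_fixedSpace {m : ℕ} (hm : Module.finrank (ZMod 2) K = 2 * m) {z : K}
    (h : ∀ e ∈ fixedSpace K m, tr (e * z) = 0) : z ^ 2 ^ m = z := by
  rw [← CharTwo.add_eq_zero]
  refine eq_zero_of_tr_mul fun c => ?_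
  rw [mul_comm, mul_add, map_add, tr_mul_conj hm, ← map_add, ← add_mul]
  refine h _ ?_
  rw [mem_fixedSpace, add_pow_char_pow, conj_conj hm, add_comm]

theorem IsInverseSpace.exists_linearMap (hD : IsInverseSpace D)
    (h : ∀ x, (x, (0 : K)) ∈ D → x = 0) :
    ∃ A : K →ₗ[ZMod 2] K, ∀ x y, (x, y) ∈ D ↔ x = A y := by
  have hex := hD.exists_mem_of_snd h
  have huniq : ∀ x x' y, (x, y) ∈ D → (x', y) ∈ D → x = x' := fun x x' y h1 h2 => by
    have := D.sub_mem h1 h2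
    rw [Prod.mk_sub_mk, sub_self] at this
    exact sub_eq_zero.1 (h _ this)
  choose f hf using hex
  refine ⟨{ toFun := f
            map_add' := fun y y' => huniq _ _ _ (hf _) (D.add_mem (hf y) (hf y'))
            map_smul' := fun c y => huniq _ _ _ (hf _) (D.smul_mem c (hf y)) }, fun x y => ?_⟩
  exact ⟨fun h => huniq _ _ _ h (hf y), fun h => h ▸ hf y⟩

theorem IsInverseSpace.odd_false {A : K →ₗ[ZMod 2] K} (hD : IsInverseSpace D)
    (hA : ∀ x y, (x, y) ∈ D ↔ x = A y) (hinj : ∀ y, A y = 0 → y = 0)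
    (hn : Odd (Module.finrank (ZMod 2) K)) : False := by
  have halt : ∀ y, tr (A y * y) = 0 := fun y => hD.tr_mul _ _ ((hA _ _).2 rfl)
  have hsym : ∀ y z, tr (A y * z) = tr (A z * y) := fun y z =>
    CharTwo.add_eq_zero.1 (by rw [← map_add]; exact hD.orth ((hA _ _).2 rfl) ((hA _ _).2 rfl))
  let b := Module.finBasis (ZMod 2) K
  have hdet := det_eq_zero_of_alternating hn (Matrix.of fun i j => tr (A (b i) * b j))
    (fun i j => hsym _ _) (fun i => halt _)
  obtain ⟨v, hv, hv0⟩ := Matrix.exists_mulVec_eq_zero_iff.2 hdet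
  set y := ∑ j, v j • b j with hy
  have h1 : ∀ i, trMul (A y) (b i) = 0 := fun i => by
    rw [trMul_apply, hsym, hy, Finset.mul_sum, map_sum]
    refine Eq.trans ?_ (congrFun hv0 i)
    refine Finset.sum_congr rfl fun j _ => ?_
    rw [mul_smul_comm, map_smul, smul_eq_mul, mul_comm]
    rfl
  have h2 : trMul (A y) = 0 := b.ext fun i => by rw [h1, LinearMap.zero_apply]
  have h3 : y = 0 := hinj _ (eq_zero_of_tr_mul fun z => congrArg (fun f => f z) h2)
  refine hv (funext fun j => ?_)
  exact Fintype.linearIndependent_iff.1 b.linearIndependent v (hy.symm.trans h3) j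

/-- Chevalley–Warning gives `y ≠ 0` with `A y * y` trace-orthogonal to the fixed field. That field
is its own orthogonal, so `(A y * y)⁻¹` lies in it and has trace zero, against `tr_inv`. -/
theorem IsInverseSpace.even_false {A : K →ₗ[ZMod 2] K} (hD : IsInverseSpace D)
    (hA : ∀ x y, (x, y) ∈ D ↔ x = A y) (hinj : ∀ y, A y = 0 → y = 0) {m : ℕ} (hm0 : 0 < m)
    (hm : Module.finrank (ZMod 2) K = 2 * m) : False := by
  let E := fixedSpace K m
  let o : E := ⟨1, one_pow _⟩
  have ho : o ≠ 0 := fun h => one_ne_zero (congrArg Subtype.val h)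
  -- The form belonging to `1` vanishes identically. Dropping it leaves at most `m - 1` quadratic
  -- forms in `2 * m` variables, as the strict inequality of Chevalley–Warning needs.
  obtain ⟨C, hC⟩ := Submodule.exists_isCompl (Submodule.span (ZMod 2) {o})
  have hCdim := Submodule.finrank_add_eq_of_isCompl hC
  rw [finrank_span_singleton ho] at hCdim
  have hE : Module.finrank (ZMod 2) E ≤ m := finrank_fixedSpace_le hm0
  let e := Module.finBasis (ZMod 2) C
  let b := Module.finBasis (ZMod 2) K
  obtain ⟨v, hv, hv0⟩ := exists_common_zero (n := Module.finrank (ZMod 2) K)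
    (m := Module.finrank (ZMod 2) C) (by omega)
    (fun j i k => tr (((e j : E) : K) * (A (b i) * b k)))
  set y := ∑ j, v j • b j with hy
  have hy0 : y ≠ 0 := fun h => hv <| funext fun j =>
    Fintype.linearIndependent_iff.1 b.linearIndependent v (hy.symm.trans h) j
  have hexp : ∀ c : K, tr (c * (A y * y)) = ∑ i, ∑ k, tr (c * (A (b i) * b k)) * (v i * v k) := by
    intro c
    rw [hy, map_sum, Finset.sum_mul_sum, Finset.mul_sum, map_sum]
    refine Finset.sum_congr rfl fun i _ => ?_
    rw [Finset.mul_sum, map_sum]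
    refine Finset.sum_congr rfl fun k _ => ?_
    rw [map_smul, smul_mul_smul_comm, mul_smul_comm, map_smul, smul_eq_mul, mul_comm]
  have hC0 : ∀ c : C, tr (((c : E) : K) * (A y * y)) = 0 := by
    let g : C →ₗ[ZMod 2] ZMod 2 := trMul (A y * y) ∘ₗ E.subtype ∘ₗ C.subtype
    have hg : g = 0 := e.ext fun j => by
      change tr ((A y * y) * ((e j : E) : K)) = 0
      rw [mul_comm, hexp]
      exact hv0 j
    intro c
    rw [mul_comm]
    exact congrArg (fun f => f c) hg
  have hz : (A y * y) ^ 2 ^ m = A y * y := by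
    refine conj_eq_of_orth_fixedSpace hm fun x hx => ?_
    have : (⟨x, hx⟩ : E) ∈ Submodule.span (ZMod 2) {o} ⊔ C := by
      rw [hC.sup_eq_top]; trivial
    obtain ⟨p, hp, c, hc, hpc⟩ := Submodule.mem_sup.1 this
    obtain ⟨a, rfl⟩ := Submodule.mem_span_singleton.1 hp
    have hx' : x = a • (1 : K) + ((c : E) : K) := (congrArg Subtype.val hpc).symm
    rw [hx', add_mul, map_add, smul_mul_assoc, one_mul, map_smul,
      hD.tr_mul _ _ ((hA _ _).2 rfl), hC0 ⟨c, hc⟩, smul_zero, add_zero]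
  have h1 := hD.tr_inv _ _ ((hA _ _).2 rfl) (fun h => hy0 (hinj y h)) hy0
  rw [tr_eq_zero_of_conj_eq hm (by rw [inv_pow, hz])] at h1
  exact zero_ne_one h1

end NoAxis

/-! ### Spaces meeting exactly one axis: odd dimension. -/

section OneAxis

variable {K : Type*} [Field K] [Fintype K] [Algebra (ZMod 2) K] [CharP K 2]

variable {D : Submodule (ZMod 2) (K × K)} {A : K →ₗ[ZMod 2] K}

theorem IsInverseSpace.alternating (hD : IsInverseSpace D) (hA : ∀ x y, (x, y) ∈ D ↔ x = A y)
    (y : K) : tr (A y * y) = 0 :=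
  hD.tr_mul _ _ ((hA _ _).2 rfl)

theorem IsInverseSpace.selfAdjoint (hD : IsInverseSpace D) (hA : ∀ x y, (x, y) ∈ D ↔ x = A y)
    (y z : K) : tr (A y * z) = tr (A z * y) :=
  CharTwo.add_eq_zero.1 (by rw [← map_add]; exact hD.orth ((hA _ _).2 rfl) ((hA _ _).2 rfl))

theorem IsInverseSpace.apply_apply (hD : IsInverseSpace D) (hA : ∀ x y, (x, y) ∈ D ↔ x = A y)
    (h1 : A 1 = 0) (y : K) : A (A y) = A y ^ 2 + A (rt y) := by
  have h := (hA _ _).1 (hD.star_zero_one ((hA 0 1).2 h1.symm) ((hA _ y).2 rfl))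
  rw [map_add] at h
  linear_combination -h - A (rt y) * CharTwo.two_eq_zero (R := K)

/-- `A` commutes with the sum of the Frobenius automorphism and its inverse. -/
theorem IsInverseSpace.comm (hD : IsInverseSpace D) (hA : ∀ x y, (x, y) ∈ D ↔ x = A y)
    (h1 : A 1 = 0) (y : K) : A (y ^ 2 + rt y) = A y ^ 2 + rt (A y) := by
  have h2 := CharTwo.two_eq_zero (R := K)
  let F : Module.End (ZMod 2) K := frob.toLinearMap
  let R : Module.End (ZMod 2) K := rt.toLinearMap
  have hF : ∀ x, F x = x ^ 2 := frob_apply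
  have hR : ∀ x, R x = rt x := fun _ => rfl
  let B : Module.End (ZMod 2) K := A
  -- The identity `A² = F A + A R` is this factorisation. One-sided inverses are two-sided, and the
  -- reversed product gives `A² = A F + R A`.
  have hmul : (B + F) * (B + R) = 1 := by
    ext x
    change A (A x + R x) + F (A x + R x) = x
    rw [map_add, hD.apply_apply hA h1, hF, hR, add_sq, rt_sq]
    linear_combination (A x ^ 2 + A (rt x) + A x * rt x) * h2
  have hmul' := LinearMap.congr_fun (mul_eq_one_comm.1 hmul) y
  change A (A y + F y) + R (A y + F y) = y at hmul'
  rw [map_add, map_add, hD.apply_apply hA h1, hF, hR, hR, rt_sq'] at hmul'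
  rw [map_add]
  linear_combination hmul' - (A y ^ 2 + rt (A y)) * h2 

/-- Any two members of a normal basis are Galois conjugate, hence differ by a Frobenius power, so
all matrix entries of the form `tr (y * H z)` vanish. -/
theorem eq_zero_of_tr_mul_conj {H : K →ₗ[ZMod 2] K} (h : ∀ y i, tr (y * H (y ^ 2 ^ i)) = 0) :
    H = 0 := by
  let b := IsGalois.normalBasis (ZMod 2) K
  have hpow : ∀ (g : Gal(K/ZMod 2)) (x : K), ∃ i : ℕ, g x = x ^ 2 ^ i := by
    intro g x
    obtain ⟨i, rfl⟩ := (FiniteField.bijective_frobeniusAlgEquivOfAlgebraic_pow (ZMod 2) K).2 g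
    refine ⟨i, ?_⟩
    rw [AlgEquiv.coe_pow, FiniteField.coe_frobeniusAlgEquivOfAlgebraic_iterate, ZMod.card]
  refine b.ext fun g => ?_
  have h1 : trMul (H (b g)) = 0 := b.ext fun g' => by
    rw [trMul_apply, LinearMap.zero_apply, mul_comm]
    have h2 : b g = (g * g'⁻¹) (b g') := by
      rw [IsGalois.normalBasis_apply, IsGalois.normalBasis_apply (e := g'), ← AlgEquiv.mul_apply,
        inv_mul_cancel_right]
    obtain ⟨i, hi⟩ := hpow (g * g'⁻¹) (b g')
    rw [h2, hi]
    exact h _ i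
  exact eq_zero_of_tr_mul fun z => LinearMap.congr_fun h1 z

/-- The defect `H = F A R + A` (F squaring, R its inverse) is alternating and satisfies `F H F = H`.
So `tr (y * H (y ^ 4 ^ j)) = 0`, and in odd degree every Frobenius power is an even one. -/
theorem map_sq_of_odd (hn : Odd (Module.finrank (ZMod 2) K)) (halt : ∀ y, tr (A y * y) = 0)
    (hcomm : ∀ y, A (y ^ 2 + rt y) = A y ^ 2 + rt (A y)) (y : K) : A (y ^ 2) = A y ^ 2 := by
  have h2 := CharTwo.two_eq_zero (R := K)
  let H : K →ₗ[ZMod 2] K := frob.toLinearMap ∘ₗ A ∘ₗ rt.toLinearMap + A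
  have hH : ∀ y, H y = A (rt y) ^ 2 + A y := fun y => by
    change frob (A (rt y)) + A y = _
    rw [frob_apply]
  have hstep : ∀ y, H (y ^ 2) ^ 2 = H y := by
    intro y
    have h3 := congrArg (· ^ 2) (hcomm y)
    simp only [map_add, add_sq, rt_sq] at h3
    rw [hH, hH, rt_sq', add_sq]
    linear_combination -h3 + (A y ^ 2 * A (y ^ 2) + A (y ^ 2) ^ 2 + A (y ^ 2) * A (rt y) -
      A y ^ 2 * rt (A y) - A y) * h2
  have hiter : ∀ j y, H (y ^ 2 ^ j) ^ 2 ^ j = H y := by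
    intro j
    induction j with
    | zero => simp
    | succ j ih =>
      intro y
      rw [show y ^ 2 ^ (j + 1) = (y ^ 2) ^ 2 ^ j by rw [← pow_mul, ← pow_succ'], pow_succ 2 j,
        pow_mul, ih, hstep]
  have haltH : ∀ y, tr (y * H y) = 0 := by
    intro y
    have h3 : tr (y * A (rt y) ^ 2) = 0 := by
      rw [← halt (rt y), ← tr_sq (A (rt y) * rt y), mul_pow, rt_sq, mul_comm]
    rw [hH, mul_add, map_add, h3, mul_comm, halt, zero_add]
  have hconj : ∀ y j, tr (y * H (y ^ 2 ^ (2 * j))) = 0 := by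
    intro y j
    rw [← tr_pow_two_pow _ j, mul_pow, two_mul, pow_add, pow_mul, hiter, haltH]
  have hH0 : H = 0 := by
    refine eq_zero_of_tr_mul_conj fun y i => ?_
    obtain ⟨k, hk⟩ := hn
    have h3 : ∀ i : ℕ, y ^ 2 ^ (i * Module.finrank (ZMod 2) K) = y := by
      intro i
      induction i with
      | zero => simp
      | succ i ih => rw [Nat.succ_mul, pow_add, pow_mul, ih, pow_two_pow_finrank]
    -- With degree `2 * k + 1`, the exponent `2 * i * (k + 1)` is congruent to `i` modulo the
    -- degree.
    have h4 := hconj y (i * (k + 1))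
    rwa [show 2 * (i * (k + 1)) = i * (2 * k + 1) + i by ring, pow_add, pow_mul, ← hk, h3] at h4
  have h5 := hH (y ^ 2)
  rw [hH0, LinearMap.zero_apply, rt_sq'] at h5
  exact (CharTwo.add_eq_zero.1 h5.symm).symm

theorem tr_one_of_odd (hn : Odd (Module.finrank (ZMod 2) K)) : tr (1 : K) = 1 := by
  have := Algebra.trace_algebraMap (R := ZMod 2) (S := K) 1
  rw [map_one] at this
  rw [this, nsmul_one]
  exact ZMod.natCast_eq_one_iff_odd.2 hn

/-- The kernel of `A` is `{0, 1}`. -/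
theorem IsInverseSpace.ker_of_odd (hD : IsInverseSpace D) (hA : ∀ x y, (x, y) ∈ D ↔ x = A y)
    (h1 : A 1 = 0) (hA0 : A ≠ 0) (hn : Odd (Module.finrank (ZMod 2) K)) {w : K} (hw : A w = 0) :
    w = 0 ∨ w = 1 := by
  have h2 := CharTwo.two_eq_zero (R := K)
  have hsq := map_sq_of_odd hn (hD.alternating hA) (hD.comm hA h1)
  -- Scaling moves `(0, w)` to `(0, 1)`, so `u ↦ w * A (w * u)` also commutes with squaring.
  -- Comparing with `A` gives the relation, which cannot hold for both `w` and `w + 1`.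
  have key : ∀ w u : K, A w = 0 → w ≠ 0 → A u = w * A (w * u) := by
    intro w u hw hw0
    let μ := Units.mk0 w hw0
    let A' : K →ₗ[ZMod 2] K := LinearMap.mulLeft (ZMod 2) w ∘ₗ A ∘ₗ LinearMap.mulLeft (ZMod 2) w
    have hA' : ∀ x y, (x, y) ∈ _root_.scaleSpace μ D ↔ x = A' y := by
      intro x y
      rw [mem_scaleSpace, hA]
      exact inv_mul_eq_iff_eq_mul₀ hw0
    have hD' := hD.scaleSpace μ
    have h3 : A' 1 = 0 := by
      change w * A (w * 1) = 0
      rw [mul_one, hw, mul_zero]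
    have h4 := map_sq_of_odd hn (hD'.alternating hA') (hD'.comm hA' h3) (rt (w⁻¹ * u))
    rw [rt_sq] at h4
    change w * A (w * (w⁻¹ * u)) = (w * A (w * rt (w⁻¹ * u))) ^ 2 at h4
    rw [mul_inv_cancel_left₀ hw0, mul_pow, ← hsq, mul_pow, rt_sq,
      show w ^ 2 * (w⁻¹ * u) = w * u by field_simp] at h4
    apply mul_left_cancel₀ hw0
    rw [h4]
    ring
  by_contra! h
  have hw1 : w + 1 ≠ 0 := fun h' => h.2 (CharTwo.add_eq_zero.1 h')
  obtain ⟨u, hu⟩ : ∃ u, A u ≠ 0 := by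
    by_contra! h'
    exact hA0 (LinearMap.ext h')
  have h3 := key w u hw h.1
  have h4 := key (w + 1) u (by rw [map_add, hw, h1, add_zero]) hw1
  rw [add_mul w 1 u, one_mul, map_add] at h4
  have h5 : (w ^ 2 + w + 1) * A u = 0 := by
    linear_combination (-w) * h4 + (w + 1) * h3
  have h6 : w ^ 2 + w = 1 :=
    CharTwo.add_eq_zero.1 ((mul_eq_zero.1 h5).resolve_right hu)
  have h7 := tr_one_of_odd hn
  rw [← h6, map_add, tr_sq, CharTwo.add_self_eq_zero] at h7
  exact zero_ne_one h7

/-- `A` sends the difference of the two sides to 0, so the difference is 0 or 1; its trace is 0,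
whereas `tr 1 = 1`. -/
theorem IsInverseSpace.apply_eq_of_odd (hD : IsInverseSpace D)
    (hA : ∀ x y, (x, y) ∈ D ↔ x = A y) (h1 : A 1 = 0) (hA0 : A ≠ 0)
    (hn : Odd (Module.finrank (ZMod 2) K)) (y : K) : A y = y ^ 2 + rt y := by
  have hsq := map_sq_of_odd hn (hD.alternating hA) (hD.comm hA h1)
  have h3 : A (A y + (y ^ 2 + rt y)) = 0 := by
    rw [map_add, map_add, hD.apply_apply hA h1, hsq, CharTwo.add_self_eq_zero]
  rcases hD.ker_of_odd hA h1 hA0 hn h3 with h | h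
  · exact CharTwo.add_eq_zero.1 h
  · exfalso
    have h4 := hD.selfAdjoint hA y 1
    rw [h1, zero_mul, map_zero, mul_one] at h4
    have h5 := congrArg tr h
    rw [map_add, map_add, tr_sq, tr_rt, CharTwo.add_self_eq_zero, h4, add_zero,
      tr_one_of_odd hn] at h5
    exact zero_ne_one h5

theorem exists_cube_eq_of_odd (hn : Odd (Module.finrank (ZMod 2) K)) (c : K) :
    ∃ y, y ^ 3 = c := by
  obtain ⟨k, hk⟩ := hn
  have h3 : 3 ∣ 4 ^ (k + 1) - 1 := by
    simpa using Nat.sub_dvd_pow_sub_pow 4 1 (k + 1)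
  obtain ⟨j, hj⟩ := h3
  rcases eq_or_ne c 0 with rfl | hc
  · exact ⟨0, by norm_num⟩
  refine ⟨c ^ j, ?_⟩
  apply mul_right_cancel₀ hc
  -- Thus `(c ^ j) ^ 3 * c = c ^ (2 ^ n * 2) = c ^ 2`, with n the degree.
  have h4 : j * 3 + 1 = 2 ^ Module.finrank (ZMod 2) K * 2 := by
    have : 1 ≤ 4 ^ (k + 1) := Nat.one_le_pow _ _ (by norm_num)
    rw [hk, ← pow_succ, show 2 * k + 1 + 1 = 2 * (k + 1) by ring, pow_mul]
    norm_num
    omega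
  rw [← pow_mul, ← pow_succ, h4, pow_mul, pow_two_pow_finrank, sq]

theorem exists_trMul_eq_zero_not_mem (hn : 4 ≤ Module.finrank (ZMod 2) K) {c : K} (hc : c ≠ 0)
    (S : Finset K) (hS : S.card ≤ 4) : ∃ e, tr (c * e) = 0 ∧ e ∉ S := by
  classical
  by_contra! h
  have h1 := card_trMul_eq_one hc
  have h2 := Finset.card_filter_add_card_filter_not (s := Finset.univ)
    (fun u : K => trMul c u = 1)
  have h3 : (Finset.univ.filter fun u : K => ¬ trMul c u = 1).card ≤ S.card :=
    Finset.card_le_card fun u hu => h u (zmod_two_ne_one.1 (Finset.mem_filter.1 hu).2)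
  rw [h1, Finset.card_univ, card_eq_two_pow] at h2
  obtain ⟨m, hm⟩ : ∃ m, Module.finrank (ZMod 2) K = m + 4 := ⟨_, (Nat.sub_add_cancel hn).symm⟩
  rw [hm, show m + 4 - 1 = m + 3 by omega] at h2
  have h4 : 2 ^ (m + 3) = 8 * 2 ^ m := by ring
  have h5 : 2 ^ (m + 4) = 16 * 2 ^ m := by ring
  have := Nat.one_le_two_pow (n := m)
  omega

/-- With `A y = y² + √y` and cubing surjective, `tr_inv` becomes `tr (c (c + 1))⁻¹ = 1` for all `c ≠
0, 1`. This yields `tr d⁻¹ = tr d + 1`, which three arguments of sum zero refute. -/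
theorem IsInverseSpace.false_of_odd (hD : IsInverseSpace D)
    (hA : ∀ x y, (x, y) ∈ D ↔ x = A y) (h1 : A 1 = 0) (hA0 : A ≠ 0)
    (hn : Odd (Module.finrank (ZMod 2) K)) (hn4 : 4 ≤ Module.finrank (ZMod 2) K) : False := by
  classical
  have h2 := CharTwo.two_eq_zero (R := K)
  have htr1 := tr_one_of_odd hn
  have hcube : ∀ c : K, c ≠ 0 → c ≠ 1 → tr c⁻¹ + tr (c + 1)⁻¹ = 1 := by
    intro c hc0 hc1
    obtain ⟨y, rfl⟩ := exists_cube_eq_of_odd hn c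
    have hy0 : y ≠ 0 := by rintro rfl; exact hc0 (by norm_num)
    have hy1 : y ≠ 1 := by rintro rfl; exact hc1 (by norm_num)
    have hAy : A y ≠ 0 := fun h => by
      rcases hD.ker_of_odd hA h1 hA0 hn h with h | h
      · exact hy0 h
      · exact hy1 h
    have h3 := hD.tr_inv _ _ ((hA _ y).2 rfl) hAy hy0
    have hc1' : y ^ 3 + 1 ≠ 0 := fun h => hc1 (CharTwo.add_eq_zero.1 h)
    rw [← tr_sq, hD.apply_eq_of_odd hA h1 hA0 hn, inv_pow, mul_pow, add_sq, rt_sq,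
      show (y ^ 2) ^ 2 + 2 * y ^ 2 * rt y + y = y * (y ^ 3 + 1) by
        linear_combination y ^ 2 * rt y * h2] at h3
    rw [← h3, ← map_add]
    congr 1
    field_simp
    linear_combination y ^ 3 * h2
  have hinv : ∀ d : K, d ≠ 0 → d ≠ 1 → tr d⁻¹ = tr d + 1 := by
    intro d hd0 hd1
    have hd1' : d + 1 ≠ 0 := fun h => hd1 (CharTwo.add_eq_zero.1 h)
    have h3 := hcube d hd0 hd1
    have h4 := hcube d⁻¹ (inv_ne_zero hd0) (fun h => hd1 (inv_eq_one.1 h))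
    have h5 : (d⁻¹ + 1)⁻¹ = 1 + (d + 1)⁻¹ := by
      rw [show d⁻¹ + 1 = (d + 1) * d⁻¹ by field_simp; ring, mul_inv, inv_inv]
      field_simp
      linear_combination -h2
    rw [inv_inv, h5, map_add, htr1] at h4
    revert h3 h4
    generalize tr d⁻¹ = p
    generalize tr d = q
    generalize tr (d + 1)⁻¹ = r
    revert p q r
    decide
  obtain ⟨s, -, hs⟩ := exists_trMul_eq_zero_not_mem hn4 one_ne_zero {0, 1} (by
    exact (Finset.card_le_two).trans (by norm_num))
  simp only [Finset.mem_insert, Finset.mem_singleton, not_or] at hs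
  obtain ⟨hs0, hs1⟩ := hs
  have hs1' : s + 1 ≠ 0 := fun h => hs1 (CharTwo.add_eq_zero.1 h)
  have hc : 1 + s⁻¹ + (s + 1)⁻¹ ≠ 0 := by
    intro h
    field_simp at h
    have h6 : s ^ 2 + s = 1 := by linear_combination h - (s + 1) * h2
    have h7 := htr1
    rw [← h6, map_add, tr_sq, CharTwo.add_self_eq_zero] at h7
    exact zero_ne_one h7
  -- The arguments `e⁻¹`, `s e⁻¹`, `(s + 1) e⁻¹` sum to 0, so by `hinv` their inverses have total
  -- trace 1; but the inverses sum to a multiple of `e` chosen to have trace 0.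
  obtain ⟨e, he, heS⟩ := exists_trMul_eq_zero_not_mem hn4 hc {0, 1, s, s + 1} Finset.card_le_four
  simp only [Finset.mem_insert, Finset.mem_singleton, not_or] at heS
  obtain ⟨he0, he1, hes, hes1⟩ := heS
  have e1 := hinv e⁻¹ (inv_ne_zero he0) (fun h => he1 (inv_eq_one.1 h))
  have e2 := hinv (s * e⁻¹) (mul_ne_zero hs0 (inv_ne_zero he0))
    (fun h => hes ((mul_inv_eq_one₀ he0).1 h).symm)
  have e3 := hinv ((s + 1) * e⁻¹) (mul_ne_zero hs1' (inv_ne_zero he0))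
    (fun h => hes1 ((mul_inv_eq_one₀ he0).1 h).symm)
  have e4 : (1 + s⁻¹ + (s + 1)⁻¹) * e = e⁻¹⁻¹ + (s * e⁻¹)⁻¹ + ((s + 1) * e⁻¹)⁻¹ := by
    field_simp
  rw [e4, map_add, map_add, e1, e2, e3, add_mul, one_mul, map_add] at he
  revert he
  generalize tr e⁻¹ = p
  generalize tr (s * e⁻¹) = q
  revert p q
  decide

end OneAxis

/-! ### Spaces meeting exactly one axis: even dimension. -/

/-- An endomorphism commuting with `f + g`, where `g = f⁻¹`, commutes with all `f ^ j + g ^ j`. -/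
theorem Commute.pow_add_pow_of_mul_eq_one {R : Type*} [Ring R] {a f g : R} (hfg : f * g = 1)
    (hgf : g * f = 1) (h : Commute a (f + g)) (j : ℕ) : Commute a (f ^ j + g ^ j) := by
  have key : ∀ j, Commute a (f ^ j + g ^ j) ∧ Commute a (f ^ (j + 1) + g ^ (j + 1)) := by
    intro j
    induction j with
    | zero =>
      refine ⟨?_, by simpa using h⟩
      simp
    | succ j ih =>
      refine ⟨ih.2, ?_⟩
      have e1 : f * g ^ (j + 1) = g ^ j := by rw [pow_succ', ← mul_assoc, hfg, one_mul]
      have e2 : g * f ^ (j + 1) = f ^ j := by rw [pow_succ', ← mul_assoc, hgf, one_mul]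
      have : f ^ (j + 1 + 1) + g ^ (j + 1 + 1) =
          (f + g) * (f ^ (j + 1) + g ^ (j + 1)) - (f ^ j + g ^ j) := by
        rw [add_mul, mul_add, mul_add, e1, e2, pow_succ' f (j + 1), pow_succ' g (j + 1)]
        abel
      rw [this]
      exact (h.mul_right ih.2).sub_right ih.1
  exact (key j).1

section OneAxisEven

variable {K : Type*} [Field K] [Fintype K] [Algebra (ZMod 2) K] [CharP K 2]

variable {D : Submodule (ZMod 2) (K × K)} {A : K →ₗ[ZMod 2] K}

theorem IsInverseSpace.comm_pow (hD : IsInverseSpace D) (hA : ∀ x y, (x, y) ∈ D ↔ x = A y)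
    (h1 : A 1 = 0) (j : ℕ) (y : K) :
    A (y ^ 2 ^ j + rt^[j] y) = A y ^ 2 ^ j + rt^[j] (A y) := by
  let F : Module.End (ZMod 2) K := frob.toLinearMap
  let R : Module.End (ZMod 2) K := rt.toLinearMap
  have hFj : ∀ x, (F ^ j) x = x ^ 2 ^ j := fun x => by
    induction j with
    | zero => simp
    | succ j ih => rw [pow_succ', Module.End.mul_apply, ih, pow_succ, pow_mul]; exact frob_apply _
  have hRj : ∀ x, (R ^ j) x = rt^[j] x := fun x => by
    rw [Module.End.pow_apply]; rfl
  have hFR : F * R = 1 := LinearMap.ext fun x => frob.apply_symm_apply x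
  have hRF : R * F = 1 := LinearMap.ext fun x => frob.symm_apply_apply x
  have hc : Commute (A : Module.End (ZMod 2) K) (F + R) := LinearMap.ext fun x => by
    change A (frob x + rt x) = frob (A x) + rt (A x)
    rw [frob_apply, frob_apply]
    exact hD.comm hA h1 x
  have := LinearMap.congr_fun (Commute.pow_add_pow_of_mul_eq_one hFR hRF hc j) y
  change A ((F ^ j) y + (R ^ j) y) = (F ^ j) (A y) + (R ^ j) (A y) at this
  rwa [hFj, hFj, hRj, hRj] at this

theorem iterate_rt_pow (j : ℕ) (x : K) : (rt^[j] x) ^ 2 ^ j = x := by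
  induction j generalizing x with
  | zero => simp
  | succ j ih => rw [Function.iterate_succ_apply, pow_succ, pow_mul, ih, rt_sq]

theorem pow_two_pow_injective {x y : K} (j : ℕ) (h : x ^ 2 ^ j = y ^ 2 ^ j) : x = y := by
  induction j with
  | zero => simpa using h
  | succ j ih => rw [pow_succ, pow_mul, pow_mul] at h; exact ih (sq_injective h)

/-- Every `y` fixed by the conjugation has an image that is fixed up to an element of `𝔽₂`. -/
theorem IsInverseSpace.conj_apply_add (hD : IsInverseSpace D)
    (hA : ∀ x y, (x, y) ∈ D ↔ x = A y) (h1 : A 1 = 0) {m : ℕ} {y : K}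
    (hy : y ∈ fixedSpace K m) : A y ^ 2 ^ m + A y = 0 ∨ A y ^ 2 ^ m + A y = 1 := by
  rw [mem_fixedSpace] at hy
  rcases Nat.even_or_odd' m with ⟨r, rfl | rfl⟩
  · left
    -- On `y` the r-th powers of Frobenius and of its inverse agree, so the left side of `comm_pow`
    -- vanishes.
    have h3 : rt^[r] y = y ^ 2 ^ r := by
      apply pow_two_pow_injective r
      rw [iterate_rt_pow, ← pow_mul, ← pow_add, ← two_mul, hy]
    have h4 := hD.comm_pow hA h1 r y
    rw [h3, CharTwo.add_self_eq_zero, map_zero] at h4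
    have h5 := congrArg (· ^ 2 ^ r) h4.symm
    simp only [add_pow_char_pow, iterate_rt_pow] at h5
    rwa [← pow_mul, ← pow_add, ← two_mul, zero_pow (by positivity)] at h5
  · have h3 : rt^[r] y = y ^ 2 ^ (r + 1) := by
      apply pow_two_pow_injective r
      rw [iterate_rt_pow, ← pow_mul, ← pow_add, show r + 1 + r = 2 * r + 1 by ring, hy]
    have h3' : rt^[r + 1] y = y ^ 2 ^ r := by
      apply pow_two_pow_injective (r + 1)
      rw [iterate_rt_pow, ← pow_mul, ← pow_add, show r + (r + 1) = 2 * r + 1 by ring, hy]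
    -- For `j = r` and `j = r + 1` the left sides of `comm_pow` coincide on `y`; equating the right
    -- sides gives a quadratic equation for `A y ^ 2 ^ m + A y`.
    have h4 := hD.comm_pow hA h1 r y
    have h4' := hD.comm_pow hA h1 (r + 1) y
    rw [h3'] at h4'
    rw [h3, add_comm (y ^ 2 ^ r), h4'] at h4
    have h5 := congrArg (· ^ 2 ^ (r + 1)) h4
    have h6 : (rt^[r] (A y)) ^ 2 ^ (r + 1) = A y ^ 2 := by
      rw [pow_succ, pow_mul, iterate_rt_pow]
    simp only [add_pow_char_pow, iterate_rt_pow, h6] at h5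
    rw [← pow_mul, ← pow_add, ← pow_mul, ← pow_add, show r + (r + 1) = 2 * r + 1 by ring,
      show r + 1 + (r + 1) = 2 * r + 1 + 1 by ring, pow_succ, pow_mul] at h5
    set X := A y ^ 2 ^ (2 * r + 1)
    have h7 : (X + A y) * (X + A y + 1) = 0 := by
      linear_combination h5 + (A y ^ 2 + X * A y + X) * CharTwo.two_eq_zero (R := K)
    rcases mul_eq_zero.1 h7 with h | h
    · exact Or.inl h
    · exact Or.inr (CharTwo.add_eq_zero.1 h)

/-- If `y` and `A y` are fixed by the conjugation, then `A y = 0`. -/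
theorem IsInverseSpace.apply_eq_zero_of_fixed (hD : IsInverseSpace D)
    (hA : ∀ x y, (x, y) ∈ D ↔ x = A y) {m : ℕ} (hm : Module.finrank (ZMod 2) K = 2 * m) {y : K}
    (hy : y ∈ fixedSpace K m) (hAy : A y ∈ fixedSpace K m) : A y = 0 := by
  by_contra h
  have hy0 : y ≠ 0 := by rintro rfl; exact h (map_zero A)
  have h1 := hD.tr_inv _ _ ((hA _ y).2 rfl) h hy0
  rw [tr_eq_zero_of_conj_eq hm (by rw [inv_pow, mul_pow, hy, hAy])] at h1
  exact zero_ne_one h1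

/-- The map `c ↦ c + c ^ 2 ^ m` has both kernel and range inside the fixed field. -/
theorem le_finrank_fixedSpace {m : ℕ} (hm : Module.finrank (ZMod 2) K = 2 * m) :
    m ≤ Module.finrank (ZMod 2) (fixedSpace K m) := by
  let T : K →ₗ[ZMod 2] K :=
    { toFun := fun c => c + c ^ 2 ^ m
      map_add' := fun a b => by rw [add_pow_char_pow]; ring
      map_smul' := fun c x => by
        rcases zmod_two_cases c with rfl | rfl
        · simp
        · simp }
  have h := LinearMap.finrank_range_add_finrank_ker T
  have hker : LinearMap.ker T ≤ fixedSpace K m := fun c hc =>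
    (CharTwo.add_eq_zero.1 (show c + c ^ 2 ^ m = 0 from hc)).symm
  have hrange : LinearMap.range T ≤ fixedSpace K m := by
    rintro _ ⟨c, rfl⟩
    change (c + c ^ 2 ^ m) ^ 2 ^ m = c + c ^ 2 ^ m
    rw [add_pow_char_pow, conj_conj hm, add_comm]
  have h1 := Submodule.finrank_mono hker
  have h2 := Submodule.finrank_mono hrange
  omega

theorem exists_mem_fixedSpace_not_mem {m : ℕ} (hm : Module.finrank (ZMod 2) K = 2 * m)
    (hm3 : 3 ≤ m) (S : Finset K) (hS : S.card ≤ 4) : ∃ e ∈ fixedSpace K m, e ∉ S := by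
  by_contra! h
  have h1 : (fixedSpace K m : Set K).ncard ≤ S.card := by
    rw [← Set.ncard_coe_finset]
    exact Set.ncard_le_ncard h
  have h2 : (fixedSpace K m : Set K).ncard = 2 ^ Module.finrank (ZMod 2) (fixedSpace K m) := by
    rw [← Nat.card_coe_set_eq]
    exact (Module.natCard_eq_pow_finrank (K := ZMod 2)).trans (by rw [Nat.card_zmod]; rfl)
  have h3 : 2 ^ 3 ≤ 2 ^ Module.finrank (ZMod 2) (fixedSpace K m) :=
    Nat.pow_le_pow_right (by norm_num) (hm3.trans (le_finrank_fixedSpace hm))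
  omega

/-- The product of `(0, w)` and `(0, w')` is `(0, √(w w'))`. Multiplying by `(0, 1)` takes further
square roots, and as many roots as the degree return `w w'`. -/
theorem IsInverseSpace.ker_mul (hD : IsInverseSpace D) (hA : ∀ x y, (x, y) ∈ D ↔ x = A y)
    (h1 : A 1 = 0) {w w' : K} (hw : A w = 0) (hw' : A w' = 0) : A (w * w') = 0 := by
  have hrt : ∀ w w', A w = 0 → A w' = 0 → A (rt (w * w')) = 0 := by
    intro w w' hw hw'
    have := hD.star_mem _ _ _ _ ((hA 0 w).2 hw.symm) ((hA 0 w').2 hw'.symm)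
    rw [hA] at this
    simpa using this.symm
  have hiter : ∀ j w, A w = 0 → A (rt^[j] w) = 0 := by
    intro j
    induction j with
    | zero => simp
    | succ j ih =>
      intro w hw
      rw [Function.iterate_succ_apply]
      refine ih _ ?_
      simpa using hrt w 1 hw h1
  have h2 := hiter (Module.finrank (ZMod 2) K - 1) _ (hrt w w' hw hw')
  have h3 := Module.finrank_pos (R := ZMod 2) (M := K)
  convert h2 using 2
  apply pow_two_pow_injective (Module.finrank (ZMod 2) K - 1)
  rw [iterate_rt_pow]
  apply sq_injective
  rw [rt_sq, ← pow_mul, ← pow_succ, Nat.sub_add_cancel h3, pow_two_pow_finrank]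

theorem IsInverseSpace.ker_inv (hD : IsInverseSpace D) (hA : ∀ x y, (x, y) ∈ D ↔ x = A y)
    (h1 : A 1 = 0) {w : K} (hw : A w = 0) : A w⁻¹ = 0 := by
  rcases eq_or_ne w 0 with rfl | hw0
  · simp
  have hpow : ∀ j, A (w ^ j) = 0 := by
    intro j
    induction j with
    | zero => simpa using h1
    | succ j ih => rw [pow_succ]; exact hD.ker_mul hA h1 ih hw
  have hq : 1 < Fintype.card K := Fintype.one_lt_card
  have : w⁻¹ = w ^ (Fintype.card K - 2) := by
    refine inv_eq_of_mul_eq_one_right ?_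
    rw [← pow_succ', ← FiniteField.pow_card_sub_one_eq_one w hw0]
    congr 1; omega
  rw [this, hpow]

/-- The kernel is a subfield. On the fixed field any two elements outside it have their sum inside
it, which for a field of at least 8 elements forces containment; a kernel element beyond the fixed
field would make `A` zero. -/
theorem IsInverseSpace.apply_eq_zero_iff (hD : IsInverseSpace D)
    (hA : ∀ x y, (x, y) ∈ D ↔ x = A y) (h1 : A 1 = 0) (hA0 : A ≠ 0) {m : ℕ}
    (hm : Module.finrank (ZMod 2) K = 2 * m) (hm3 : 3 ≤ m) (w : K) :
    A w = 0 ↔ w ∈ fixedSpace K m := by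
  classical
  have hsum : ∀ x y, x ∈ fixedSpace K m → y ∈ fixedSpace K m → A x ≠ 0 → A y ≠ 0 →
      A (x + y) = 0 := by
    intro x y hx hy hAx hAy
    refine hD.apply_eq_zero_of_fixed hA hm (Submodule.add_mem _ hx hy) ?_
    have key : ∀ z, z ∈ fixedSpace K m → A z ≠ 0 → A z ^ 2 ^ m + A z = 1 := fun z hz hAz =>
      (hD.conj_apply_add hA h1 hz).resolve_left fun h => hAz <|
        hD.apply_eq_zero_of_fixed hA hm hz (CharTwo.add_eq_zero.1 h)
    have e1 := key x hx hAx
    have e2 := key y hy hAy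
    rw [mem_fixedSpace, map_add, add_pow_char_pow]
    linear_combination e1 + e2 + (1 - A x - A y) * CharTwo.two_eq_zero (R := K)
  have hsub : ∀ e ∈ fixedSpace K m, A e = 0 := by
    intro e he
    by_contra hAe
    -- Avoiding `0, 1, e, e + 1` ensures that whichever of `x`, `x + e` lies in the kernel is
    -- neither 0 nor 1.
    obtain ⟨h, hh, hAh, hh0, hh1⟩ : ∃ h ∈ fixedSpace K m, A h = 0 ∧ h ≠ 0 ∧ h ≠ 1 := by
      obtain ⟨x, hx, hxS⟩ := exists_mem_fixedSpace_not_mem hm hm3 {0, 1, e, e + 1}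
        Finset.card_le_four
      simp only [Finset.mem_insert, Finset.mem_singleton, not_or] at hxS
      obtain ⟨hx0, hx1, hxe, hxe1⟩ := hxS
      by_cases hAx : A x = 0
      · exact ⟨x, hx, hAx, hx0, hx1⟩
      · refine ⟨x + e, Submodule.add_mem _ hx he, hsum x e hx he hAx hAe,
          fun h => hxe (CharTwo.add_eq_zero.1 h), fun h => hxe1 ?_⟩
        rw [← h, add_comm x, ← add_assoc, CharTwo.add_self_eq_zero, zero_add]
    have hdiv : ∀ h x, A h = 0 → h ≠ 0 → A (h * x) = 0 → A x = 0 := by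
      intro h x hh hh0 hhx
      have := hD.ker_mul hA h1 (hD.ker_inv hA h1 hh) hhx
      rwa [inv_mul_cancel_left₀ hh0] at this
    have hhe : h * e ∈ fixedSpace K m := by
      rw [mem_fixedSpace, mul_pow, hh, he]
    have h3 := hsum (h * e) e hhe he (fun h' => hAe (hdiv h e hAh hh0 h')) hAe
    rw [show h * e + e = (h + 1) * e by ring] at h3
    exact hAe (hdiv (h + 1) e (by rw [map_add, hAh, h1, add_zero])
      (fun h' => hh1 (CharTwo.add_eq_zero.1 h')) h3)
  refine ⟨fun hw => ?_, hsub w⟩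
  by_contra hwE
  have hw2 : w + w ^ 2 ^ m ≠ 0 := fun h => hwE (CharTwo.add_eq_zero.1 h).symm
  refine hA0 (LinearMap.ext fun u => ?_)
  have h2 := CharTwo.two_eq_zero (R := K)
  -- Coordinates of `u` in the basis `1, w` of `K` over the fixed field.
  set b := (u + u ^ 2 ^ m) * (w + w ^ 2 ^ m)⁻¹ with hb
  have hbE : b ^ 2 ^ m = b := by
    rw [hb, mul_pow, inv_pow, add_pow_char_pow, add_pow_char_pow, conj_conj hm, conj_conj hm,
      add_comm, add_comm w]
  have hb' : b * (w + w ^ 2 ^ m) = u + u ^ 2 ^ m := by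
    rw [hb, inv_mul_cancel_right₀ hw2]
  have haE : u + b * w ∈ fixedSpace K m := by
    rw [mem_fixedSpace, add_pow_char_pow, mul_pow, hbE]
    linear_combination hb' + (u ^ 2 ^ m - b * w) * h2
  have hu : u = (u + b * w) + b * w := by
    linear_combination (-b * w) * h2
  rw [hu, map_add, hsub _ haE, hD.ker_mul hA h1 (hsub b hbE) hw]
  simp

/-- The one-axis case in even dimension is impossible. -/
theorem IsInverseSpace.false_of_even (hD : IsInverseSpace D)
    (hA : ∀ x y, (x, y) ∈ D ↔ x = A y) (h1 : A 1 = 0) (hA0 : A ≠ 0) {m : ℕ}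
    (hm : Module.finrank (ZMod 2) K = 2 * m) (hm3 : 3 ≤ m) : False := by
  classical
  have h2 := CharTwo.two_eq_zero (R := K)
  have hker := hD.apply_eq_zero_iff hA h1 hA0 hm hm3
  obtain ⟨y, hx0⟩ : ∃ y, A y ≠ 0 := by
    by_contra! h'
    exact hA0 (LinearMap.ext h')
  set x := A y with hx
  have hxE : x ^ 2 ^ m = x := by
    refine conj_eq_of_orth_fixedSpace hm fun e he => ?_
    rw [mul_comm, hx, hD.selfAdjoint hA, (hker e).2 he, zero_mul, map_zero]
  set t := y + y ^ 2 ^ m with ht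
  have ht0 : t ≠ 0 := fun h => hx0 ((hker y).2 (CharTwo.add_eq_zero.1 h).symm)
  have htE : t ^ 2 ^ m = t := by rw [ht, add_pow_char_pow, conj_conj hm, add_comm]
  -- `k` has relative trace 1, so `e ↦ tr (k * e)` restricts to the absolute trace of the fixed
  -- field.
  set k := y * t⁻¹ with hk
  have hkt : y = t * k := by rw [hk]; field_simp
  have hkc : k ^ 2 ^ m = k + 1 := by
    rw [hk, mul_pow, inv_pow, htE]
    field_simp
    rw [ht]
    linear_combination (-y) * h2
  -- the trace of `K` in terms of the relative trace
  have htr : ∀ u : K, tr u = tr (k * (u + u ^ 2 ^ m)) := by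
    intro u
    rw [mul_add, map_add, tr_mul_conj hm, hkc, add_mul, one_mul, map_add, ← add_assoc,
      CharTwo.add_self_eq_zero, zero_add]
  have htrE : ∀ e : K, e ^ 2 ^ m = e → tr e = 0 := fun e he => tr_eq_zero_of_conj_eq hm he
  set δ := k ^ 2 + k with hδ
  have hδE : δ ^ 2 ^ m = δ := by
    rw [hδ, add_pow_char_pow, ← pow_mul, mul_comm, pow_mul, hkc]
    linear_combination (k + 1) * h2
  have hsq : ∀ e : K, e ^ 2 ^ m = e → tr (k * e ^ 2) = tr (k * e) := by
    intro e he
    rw [← tr_sq (k * e), ← CharTwo.add_eq_zero, ← map_add]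
    have : k * e ^ 2 + (k * e) ^ 2 = δ * e ^ 2 := by rw [hδ]; ring
    rw [this]
    refine htrE _ ?_
    rw [mul_pow, hδE, ← pow_mul, mul_comm 2, pow_mul, he]
  set g := (x * t)⁻¹ with hg
  have hgE : g ^ 2 ^ m = g := by rw [hg, inv_pow, mul_pow, hxE, htE]
  have hg0 : g ≠ 0 := inv_ne_zero (mul_ne_zero hx0 ht0)
  clear_value g
  -- Solve `v² + v = τ`; the trace condition puts `v` outside the fixed field. Then `w = t (v + k)`
  -- lies in the kernel and `y + w = t v`, so `A (t v) = x`. Apply `tr_inv` there: the relative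
  -- trace of `(x t v)⁻¹` is `g / τ`.
  have hP : ∀ τ : K, τ ^ 2 ^ m = τ → tr (k * τ) = 1 → tr (k * (g * τ⁻¹)) = 1 := by
    intro τ hτ hτ1
    obtain ⟨v, hv⟩ := exists_sq_add_self (htrE τ hτ)
    have hvc : v ^ 2 ^ m = v + 1 := by
      have h3 : (v ^ 2 ^ m + v) * (v ^ 2 ^ m + v + 1) = 0 := by
        have h4 : (v ^ 2 ^ m) ^ 2 + v ^ 2 ^ m = τ := by
          rw [← hτ, ← hv, add_pow_char_pow, ← pow_mul, ← pow_mul, mul_comm]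
        linear_combination h4 + hv + (τ + v ^ 2 ^ m * v) * h2
      rcases mul_eq_zero.1 h3 with h | h
      · exfalso
        have hvE := CharTwo.add_eq_zero.1 h
        rw [← hv, mul_add, map_add, hsq v hvE, CharTwo.add_self_eq_zero] at hτ1
        exact zero_ne_one hτ1
      · rw [add_assoc] at h
        exact CharTwo.add_eq_zero.1 h
    set w := t * (v + k) with hw
    have hwE : w ^ 2 ^ m = w := by
      rw [hw, mul_pow, htE, add_pow_char_pow, hvc, hkc]
      linear_combination t * h2
    have hv0 : v ≠ 0 := by
      rintro rfl
      rw [zero_pow (by positivity), zero_add] at hvc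
      exact zero_ne_one hvc
    have hv1 : v + 1 ≠ 0 := by
      rw [← hvc]; exact pow_ne_zero _ hv0
    have hyw : y + w = t * v := by
      rw [hkt, hw]
      linear_combination (t * k) * h2
    have h3 := hD.tr_inv x (y + w) ((hA _ _).2 (by rw [map_add, (hker w).2 hwE, add_zero])) hx0
      (by rw [hyw]; exact mul_ne_zero ht0 hv0)
    rw [htr, hyw] at h3
    rw [← h3]
    congr 2
    rw [inv_pow, mul_pow, mul_pow, hxE, htE, hvc, hg, ← hv]
    rw [show v ^ 2 + v = v * (v + 1) by ring]
    field_simp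
    linear_combination (-v) * h2
  have hPiff : ∀ τ : K, τ ^ 2 ^ m = τ → tr (k * τ) = tr (k * (g * τ⁻¹)) := by
    intro τ hτ
    rcases zmod_two_cases (tr (k * τ)) with h0 | h0
    · rcases zmod_two_cases (tr (k * (g * τ⁻¹))) with h3 | h3
      · rw [h0, h3]
      · exfalso
        have h4 := hP (g * τ⁻¹) (by rw [mul_pow, inv_pow, hgE, hτ]) h3
        rw [mul_inv, inv_inv, mul_inv_cancel_left₀ hg0, h0] at h4
        exact zero_ne_one h4
    · rw [h0, hP τ hτ h0]
  -- The arguments `e⁻¹`, `s e⁻¹`, `(s + 1) e⁻¹` sum to 0, so `k * c` is trace-orthogonal to the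
  -- fixed field and hence in it. As `k` is not, `c = 0`. At most four elements can satisfy the
  -- outcome.
  have hcube : ∀ s : K, s ^ 2 ^ m = s → s ≠ 0 → s ≠ 1 → s ^ 2 + s + 1 = 0 := by
    intro s hs hs0 hs1
    have hs1' : s + 1 ≠ 0 := fun h => hs1 (CharTwo.add_eq_zero.1 h)
    set c := g * (1 + s⁻¹ + (s + 1)⁻¹) with hc
    have hcE : c ^ 2 ^ m = c := by
      rw [hc, mul_pow, hgE, add_pow_char_pow, add_pow_char_pow, inv_pow, inv_pow,
        add_pow_char_pow, hs, one_pow]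
    have h3 : (k * c) ^ 2 ^ m = k * c := by
      refine conj_eq_of_orth_fixedSpace hm fun e he => ?_
      have he' : e⁻¹ ^ 2 ^ m = e⁻¹ := by rw [inv_pow, he]
      have p1 := hPiff e⁻¹ he'
      have p2 := hPiff (s * e⁻¹) (by rw [mul_pow, hs, he'])
      have p3 := hPiff ((s + 1) * e⁻¹) (by
        rw [mul_pow, add_pow_char_pow, hs, one_pow, he'])
      have e1 : e * (k * c) = k * (g * e⁻¹⁻¹) + k * (g * (s * e⁻¹)⁻¹) +
          k * (g * ((s + 1) * e⁻¹)⁻¹) := by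
        rw [hc, mul_inv, mul_inv, inv_inv]
        ring
      rw [e1, map_add, map_add, ← p1, ← p2, ← p3, ← map_add, ← map_add,
        show k * e⁻¹ + k * (s * e⁻¹) + k * ((s + 1) * e⁻¹) = 0 by
          linear_combination (k * e⁻¹ + k * s * e⁻¹) * h2, map_zero]
    rw [mul_pow, hkc, hcE] at h3
    have hc0 : c = 0 := by linear_combination h3
    rw [hc] at hc0
    have h4 := (mul_eq_zero.1 hc0).resolve_left hg0
    field_simp at h4
    linear_combination h4 - s * h2
  obtain ⟨s, hs, hsS⟩ := exists_mem_fixedSpace_not_mem hm hm3 {0, 1}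
    (Finset.card_le_two.trans (by norm_num))
  simp only [Finset.mem_insert, Finset.mem_singleton, not_or] at hsS
  obtain ⟨s', hs', hsS'⟩ := exists_mem_fixedSpace_not_mem hm hm3 {0, 1, s, s + 1}
    Finset.card_le_four
  simp only [Finset.mem_insert, Finset.mem_singleton, not_or] at hsS'
  have e1 := hcube s hs hsS.1 hsS.2
  have e2 := hcube s' hs' hsS'.1 hsS'.2.1
  have e3 : (s' + s) * (s' + (s + 1)) = 0 := by
    linear_combination e1 + e2 + (s * s' - 1) * h2
  rcases mul_eq_zero.1 e3 with h | h
  · exact hsS'.2.2.1 (CharTwo.add_eq_zero.1 h)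
  · exact hsS'.2.2.2 (CharTwo.add_eq_zero.1 h)

end OneAxisEven

/-! ### Classification of inverse spaces and the equivalence statements. -/

section Final

variable {K : Type*} [Field K] [Fintype K] [Algebra (ZMod 2) K] [CharP K 2]

theorem IsInverseSpace.false_of_one_axis (hn : 5 ≤ Module.finrank (ZMod 2) K)
    {D : Submodule (ZMod 2) (K × K)} (hD : IsInverseSpace D)
    (h : ∀ x, (x, (0 : K)) ∈ D → x = 0) {w : K} (hw0 : w ≠ 0) (hw : ((0 : K), w) ∈ D)
    {x y : K} (hxy : (x, y) ∈ D) (hx : x ≠ 0) : False := by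
  set μ := Units.mk0 w hw0
  have hD' := hD.scaleSpace μ
  have hμ : (μ : K) = w := rfl
  obtain ⟨A, hA⟩ := hD'.exists_linearMap fun x hx => by
    rw [mem_scaleSpace, mul_zero] at hx
    exact (mul_eq_zero.1 (h _ hx)).resolve_left (inv_ne_zero hw0)
  have h1 : A 1 = 0 := by
    refine ((hA 0 1).1 ?_).symm
    rw [mem_scaleSpace]
    simpa [hμ] using hw
  have hA0 : A ≠ 0 := by
    rintro rfl
    have h2 : (w * x, w⁻¹ * y) ∈ _root_.scaleSpace μ D := by
      rw [mem_scaleSpace]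
      simpa [hμ, hw0] using hxy
    rw [hA, LinearMap.zero_apply] at h2
    exact mul_ne_zero hw0 hx h2
  rcases Nat.even_or_odd' (Module.finrank (ZMod 2) K) with ⟨m, hm | hm⟩
  · exact hD'.false_of_even hA h1 hA0 hm (by omega)
  · exact hD'.false_of_odd hA h1 hA0 ⟨m, hm⟩ (by omega)

theorem IsInverseSpace.eq_axis (hn : 5 ≤ Module.finrank (ZMod 2) K)
    {D : Submodule (ZMod 2) (K × K)} (hD : IsInverseSpace D) :
    (∀ x y, (x, y) ∈ D → x = 0) ∨ (∀ x y, (x, y) ∈ D → y = 0) := by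
  by_contra! hcon
  obtain ⟨⟨x₁, y₁, h₁, hx₁⟩, ⟨x₂, y₂, h₂, hy₂⟩⟩ := hcon
  by_cases hX : ∀ x, (x, (0 : K)) ∈ D → x = 0
  · by_cases hY : ∀ y, ((0 : K), y) ∈ D → y = 0
    · obtain ⟨A, hA⟩ := hD.exists_linearMap hX
      have hinj : ∀ y, A y = 0 → y = 0 := fun y hy => hY y ((hA _ _).2 hy.symm)
      rcases Nat.even_or_odd' (Module.finrank (ZMod 2) K) with ⟨m, hm | hm⟩
      · exact hD.even_false hA hinj (by omega) hm
      · exact hD.odd_false hA hinj ⟨m, hm⟩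
    · push Not at hY
      obtain ⟨w, hw, hw0⟩ := hY
      exact hD.false_of_one_axis hn hX hw0 hw h₁ hx₁
  · push Not at hX
    obtain ⟨w, hw, hw0⟩ := hX
    by_cases hY : ∀ y, ((0 : K), y) ∈ D → y = 0
    · exact hD.swapSpace.false_of_one_axis hn (fun y hy => hY y (mem_swapSpace.1 hy)) hw0
        (mem_swapSpace.2 hw) (mem_swapSpace.2 h₂) hy₂
    · push Not at hY
      obtain ⟨v, hv, hv0⟩ := hY
      set μ := Units.mk0 v hv0
      have hμ : (μ : K) = v := rfl
      -- Scaling by `v` sends `(0, v)` to `(0, 1)` and `(w, 0)` to `(v * w, 0)`.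
      refine mul_ne_zero hv0 hw0
        ((hD.scaleSpace μ).not_mem_axes (w := v * w) ?_ ?_)
      · rw [mem_scaleSpace]
        simpa [hμ] using hv
      · rw [mem_scaleSpace]
        simpa [hμ, hv0] using hw

/-- A permutation of the form `u ↦ a u + b u⁻¹` with `a`, `b` linear has `a = 0` or `b = 0`. -/
theorem eq_zero_or_eq_zero_of_bijective (hn : 5 ≤ Module.finrank (ZMod 2) K)
    {a b : K →ₗ[ZMod 2] K} (hπ : Function.Bijective fun u => a u + b u⁻¹) : a = 0 ∨ b = 0 := by
  have hD := isInverseSpace_of_bijective (by omega) hπ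
  rcases hD.eq_axis hn with h | h
  · left
    ext y
    obtain ⟨x, hx⟩ := hD.exists_mem_of_snd (fun x hx => h x 0 hx) y
    have hx0 := h x y hx
    rw [mem_inverseSpace, hx0, map_zero, add_zero] at hx
    simpa using hx
  · right
    ext x
    obtain ⟨y, hy⟩ := hD.swapSpace.exists_mem_of_snd
      (fun y hy => h 0 y (mem_swapSpace.1 hy)) x
    rw [mem_swapSpace] at hy
    have hy0 := h x y hy
    rw [mem_inverseSpace, hy0, map_zero, zero_add] at hy
    simpa using hy

theorem affineMap_apply_eq {V W : Type*} [AddCommGroup V] [Module (ZMod 2) V] [AddCommGroup W]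
    [Module (ZMod 2) W] (f : V →ᵃ[ZMod 2] W) (x : V) : f x = f.linear x + f 0 :=
  congrFun f.decomp x

theorem bijective_of_bijective_add_const {f : K → K} {c : K}
    (h : Function.Bijective fun u => f u + c) : Function.Bijective f := by
  have := (Equiv.addRight (-c)).bijective.comp h
  convert this using 1
  ext u; simp

theorem EAEquivalent.of_forall {G : K → K} {a c d : K →ₗ[ZMod 2] K} (ha : Function.Bijective a)
    (hd : Function.Bijective d) {c₁ c₂ : K}
    (h : ∀ u, G (a u + c₁) = d u⁻¹ + c u + c₂) : EAEquivalent (inverseFunction K) G := by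
  let ea : K ≃ᵃ[ZMod 2] K := (LinearEquiv.ofBijective a ha).toAffineEquiv.trans
    (AffineEquiv.constVAdd (ZMod 2) K c₁)
  let ed : K ≃ᵃ[ZMod 2] K := (LinearEquiv.ofBijective d hd).toAffineEquiv
  have hea : ∀ u, ea u = a u + c₁ := fun u => by
    change c₁ + a u = a u + c₁
    exact add_comm _ _
  refine ⟨ed, ea.symm, (c.toAffineMap + AffineMap.const (ZMod 2) K c₂).comp
    ea.symm.toAffineMap, fun x => ?_⟩
  obtain ⟨u, rfl⟩ := ea.surjective x
  rw [hea, h, ← hea, AffineMap.comp_apply, AffineEquiv.coe_toAffineMap, AffineEquiv.symm_apply_apply]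
  change d u⁻¹ + (c u + c₂) = _
  rw [add_assoc]

theorem CCZEquivalent.eaEquivalent (hn : 5 ≤ Module.finrank (ZMod 2) K) {G : K → K}
    (h : CCZEquivalent (inverseFunction K) G) : EAEquivalent (inverseFunction K) G := by
  obtain ⟨A, hA⟩ := h
  set L := A.linear with hL
  set c₁ := (A 0).1
  set c₂ := (A 0).2
  let a : K →ₗ[ZMod 2] K := LinearMap.fst _ _ _ ∘ₗ L.toLinearMap ∘ₗ LinearMap.inl _ _ _
  let b : K →ₗ[ZMod 2] K := LinearMap.fst _ _ _ ∘ₗ L.toLinearMap ∘ₗ LinearMap.inr _ _ _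
  let c : K →ₗ[ZMod 2] K := LinearMap.snd _ _ _ ∘ₗ L.toLinearMap ∘ₗ LinearMap.inl _ _ _
  let d : K →ₗ[ZMod 2] K := LinearMap.snd _ _ _ ∘ₗ L.toLinearMap ∘ₗ LinearMap.inr _ _ _
  have hLxy : ∀ x y, L (x, y) = (a x + b y, c x + d y) := fun x y => by
    have : (x, y) = (x, (0 : K)) + ((0 : K), y) := by simp
    rw [this, map_add]
    rfl
  have hAxy : ∀ x y, A (x, y) = (a x + b y + c₁, c x + d y + c₂) := fun x y => by
    have := affineMap_apply_eq A.toAffineMap (x, y)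
    rw [AffineEquiv.linear_toAffineMap] at this
    change A (x, y) = L (x, y) + A 0 at this
    rw [this, hLxy]
    rfl
  have hmem : ∀ x, G (a x + b x⁻¹ + c₁) = c x + d x⁻¹ + c₂ := fun x => by
    have h1 : A (x, x⁻¹) ∈ Set.univ.graphOn G := by
      rw [← hA]
      exact ⟨(x, x⁻¹), by simp [inverseFunction], rfl⟩
    rw [hAxy] at h1
    simpa using h1
  have hsurj : Function.Surjective fun u => a u + b u⁻¹ + c₁ := fun z => by
    have h1 : (z, G z) ∈ A '' Set.univ.graphOn (inverseFunction K) := by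
      rw [hA]; simp
    obtain ⟨⟨x, y⟩, h2, h3⟩ := h1
    have h4 : x⁻¹ = y := by simpa [inverseFunction] using h2
    subst h4
    rw [hAxy] at h3
    exact ⟨x, congrArg Prod.fst h3⟩
  have hbij := bijective_of_bijective_add_const (Finite.surjective_iff_bijective.1 hsurj)
  rcases eq_zero_or_eq_zero_of_bijective hn hbij with h0 | h0
  · rw [h0] at hbij hLxy
    simp only [h0, LinearMap.zero_apply, zero_add] at hmem hbij hLxy
    have hb : Function.Bijective b := by
      have := hbij.comp (inv_involutive (G := K)).bijective
      simpa [Function.comp_def] using this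
    have hc : Function.Injective c := by
      rw [← LinearMap.ker_eq_bot, LinearMap.ker_eq_bot']
      intro x hx
      have : L (x, 0) = 0 := by rw [hLxy, hx]; simp
      exact congrArg Prod.fst (L.map_eq_zero_iff.1 this)
    refine EAEquivalent.of_forall (c := d) hb (Finite.injective_iff_bijective.1 hc) (c₁ := c₁)
      (c₂ := c₂) fun u => ?_
    -- When `a = 0` the graph is reparametrised by `u⁻¹`, exchanging the roles of `c` and `d`.
    have := hmem u⁻¹
    rw [inv_inv] at this
    rw [this]
  · rw [h0] at hbij hLxy
    simp only [h0, LinearMap.zero_apply, add_zero] at hmem hbij hLxy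
    have hd : Function.Injective d := by
      rw [← LinearMap.ker_eq_bot, LinearMap.ker_eq_bot']
      intro y hy
      have : L (0, y) = 0 := by rw [hLxy, hy]; simp
      exact congrArg Prod.snd (L.map_eq_zero_iff.1 this)
    refine EAEquivalent.of_forall (c := c) hbij (Finite.injective_iff_bijective.1 hd) (c₁ := c₁)
      (c₂ := c₂) fun u => ?_
    rw [hmem, add_comm (c u)]

theorem EAEquivalent.cczEquivalent {V : Type*} [AddCommGroup V] [Module (ZMod 2) V]
    {F G : V → V} (h : EAEquivalent F G) : CCZEquivalent F G := by
  obtain ⟨A₁, A₂, A₃, h⟩ := h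
  let f : (V × V) →ᵃ[ZMod 2] (V × V) :=
    (A₂.symm.toAffineMap.comp AffineMap.fst).prod
      (A₁.toAffineMap.comp AffineMap.snd + (A₃.comp A₂.symm.toAffineMap).comp AffineMap.fst)
  have hf : ∀ x y, f (x, y) = (A₂.symm x, A₁ y + A₃ (A₂.symm x)) := fun x y => rfl
  have hbij : Function.Bijective f := by
    constructor
    · rintro ⟨x, y⟩ ⟨x', y'⟩ hxy
      rw [hf, hf, Prod.mk.injEq] at hxy
      have hx := A₂.symm.injective hxy.1
      subst hx
      rw [A₁.injective (add_right_cancel hxy.2)]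
    · rintro ⟨z, w⟩
      refine ⟨(A₂ z, A₁.symm (w - A₃ z)), ?_⟩
      rw [hf]
      simp
  have hcoe : ∀ x y, AffineEquiv.ofBijective hbij (x, y) = f (x, y) := fun x y => rfl
  refine ⟨AffineEquiv.ofBijective hbij, ?_⟩
  ext ⟨z, w⟩
  simp only [Set.mem_image, Set.mem_graphOn, Set.mem_univ, true_and, Prod.exists,
    hcoe, hf, Prod.mk.injEq]
  constructor
  · rintro ⟨x, y, rfl, rfl, rfl⟩
    rw [← h]
    simp
  · rintro rfl
    exact ⟨A₂ z, F (A₂ z), rfl, by simp, by rw [← h]; simp⟩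

/-- Up to a constant, `G ∘ A₂⁻¹` is `B.linear u + A₁.linear u⁻¹`. It is a permutation and `A₁.linear
≠ 0`, so `B` is constant and can be absorbed into `A₁`. -/
theorem EAEquivalent.affineEquivalent (hn : 5 ≤ Module.finrank (ZMod 2) K) {G : K → K}
    (h : EAEquivalent (inverseFunction K) G) (hG : Function.Bijective G) :
    AffineEquivalent (inverseFunction K) G := by
  obtain ⟨A₁, A₂, A₃, h⟩ := h
  let B := A₃.comp A₂.symm.toAffineMap
  have h1 : ∀ u, G (A₂.symm u) = B.linear u + A₁.linear u⁻¹ + (B 0 + A₁ 0) := fun u => by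
    rw [← h]
    have e1 := affineMap_apply_eq B u
    have e2 := affineMap_apply_eq A₁.toAffineMap u⁻¹
    rw [AffineEquiv.linear_toAffineMap] at e2
    change A₁ u⁻¹ = A₁.linear u⁻¹ + A₁ 0 at e2
    rw [AffineEquiv.apply_symm_apply]
    change A₁ u⁻¹ + B u = _
    rw [e1, e2]
    ring
  have h2 := hG.comp A₂.symm.bijective
  have h3 : Function.Bijective fun u => B.linear u + A₁.linear.toLinearMap u⁻¹ := by
    refine bijective_of_bijective_add_const (c := B 0 + A₁ 0) ?_
    convert h2 using 1
    ext u
    exact (h1 u).symm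
  rcases eq_zero_or_eq_zero_of_bijective hn h3 with h0 | h0
  · refine ⟨A₁.trans (AffineEquiv.constVAdd (ZMod 2) K (B 0)), A₂, fun x => ?_⟩
    rw [← h]
    change B 0 + A₁ (inverseFunction K (A₂ x)) = _
    have e1 := affineMap_apply_eq B (A₂ x)
    rw [h0, LinearMap.zero_apply, zero_add] at e1
    have e2 : B (A₂ x) = A₃ x := by simp [B]
    rw [← e2, e1, add_comm]
  · exfalso
    have : A₁.linear (1 : K) = 0 := congrArg (fun f => f (1 : K)) h0
    exact one_ne_zero (A₁.linear.map_eq_zero_iff.1 this)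

end Final

theorem mainTheorem1 (n : ℕ) (hn : 5 ≤ n) (K : Type*) [Field K] [Algebra (ZMod 2) K]
    (hK : Nat.card K = 2 ^ n) :
    {G : K → K | CCZEquivalent (inverseFunction K) G} =
        {G : K → K | EAEquivalent (inverseFunction K) G} ∧
      ∀ G : K → K, CCZEquivalent (inverseFunction K) G → Function.Bijective G →
        AffineEquivalent (inverseFunction K) G := by
  have hfin : Finite K := Nat.finite_of_card_ne_zero (by rw [hK]; positivity)
  have := Fintype.ofFinite K
  have : CharP K 2 := charP_of_injective_algebraMap (algebraMap (ZMod 2) K).injective 2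
  have hn' : 5 ≤ Module.finrank (ZMod 2) K := by
    rw [Nat.card_eq_fintype_card, card_eq_two_pow] at hK
    rw [Nat.pow_right_injective le_rfl hK]
    exact hn
  refine ⟨?_, fun G h hG => (h.eaEquivalent hn').affineEquivalent hn' hG⟩
  ext G
  exact ⟨fun h => CCZEquivalent.eaEquivalent hn' h, fun h => EAEquivalent.cczEquivalent h⟩
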